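/- Let $S^3=\mathbb{R}^3\cup\{\infty\}$ and write $[x,y]=x^{-1}y^{-1}xy$. Let $\mathcal B\subset S^3$ be the Borromean rings, realised as the union of three curves, the top, left and right ring, with $(p,q)=(0,1),(-1,0),(1,0)$ respectively: $$\Big\{(x,y,z)\in\mathbb{R}^3 : (x-p)^2+3(y-q)^2=4,\ z=\tfrac12\big((x-p)^3-3(x-p)\big)\Big\}.$$ Their projection to the $(x,y)$-plane is the standard alternating diagram of three ellipses with six crossings, in which the right ring lies over the left one, the left one over the top one, and the top one over the right one. The diagram has six arcs: $a$ and $d$ are the arcs of the top ring outside and inside the left ellipse, $b$ and $e$ those of the left ring outside and inside the right ellipse, $c$ and $f$ those of the right ring outside and inside the top ellipse. The base point is $(0,0,10)$. Each arc is also a name for the class in $\pi_1(S^3\setminus\mathcal B)$ of a meridian loop, namely the triangular loop that descends from the base point to a point below the diagram outside the ellipse of that arc, passes below the arc into that ellipse, and returns to the base point; explicitly, the two lower vertices are, in this order, $(0,3,-2),(0,2,-2)$ for $a$; $(-4,-1,-2),(-2,-\frac12,-2)$ for $b$; $(4,-1,-2),(2,-\frac12,-2)$ for $c$; $(-2,-\frac12,-2),(-\frac32,\frac12,-2)$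 for $d$; $(2,-\frac12,-2),(0,-\frac12,-2)$ for $e$; $(0,2,-2),(\frac32,\frac12,-2)$ for $f$. In a product $gh$ of classes the loop $h$ is traversed first. Then: 1. (Wirtinger presentation.) The meridians $a,\dots,f$ generate $\pi_1(S^3\setminus\mathcal B)$, with the defining relators $$R_1=d^{-1}bab^{-1},\quad R_2=fdc^{-1}d^{-1},\quad R_3=efb^{-1}f^{-1},\quad R_4=fac^{-1}a^{-1},\quad R_5=ecb^{-1}c^{-1},\quad R_6=dea^{-1}e^{-1}.$$ 2. After the substitution $d=bab^{-1}$, $e=cbc^{-1}$, $f=aca^{-1}$, the identity $R_6=(R_3R_2)^{-1}$ holds in the free group on $a,b,c$. 3. (Reduced presentation.) The meridians $a,b,c$ generate $\pi_1(S^3\setminus\mathcal B)$, with the two defining relators below: $$\pi_1(S^3\setminus\mathcal{B})=\big\langle a,b,c \;\big|\; [c^{-1},[b^{-1},a]]=[b,[c,a^{-1}]]=1\big\rangle .$$ In particular, for every base point in $S^3\setminus\mathcal B$ the fundamental group is isomorphic to the group with this presentation. -/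

import Mathlib

/-! ### The Borromean rings in the 3-sphere

The 3-sphere is the one-point compactification of `ℝ³`, and the projection plane is `z = 0`.
The diagram consists of the three circles of radius `2` centred at `(±1, 0)` and `(0, √3)`; the
second coordinate is divided by `√3`, so the circles become the ellipses
`(x - p) ^ 2 + 3 * (y - q) ^ 2 = 4` with centres `(±1, 0)` and `(0, 1)`, and the six crossings are
`(0, ±1)`, `(±2, 1)`, `(±1, 0)`.

A point at angle `θ` of a circle gets the height `cos (3 * θ)`. As `x - p = 2 * cos θ`, this is
`((x - p) ^ 3 - 3 * (x - p)) / 2`. It is `1` or `-1` at the crossings, with alternating signs along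
each circle: the right ring lies over the left one, the left one over the top one, and the top one
over the right one. -/

/-- Euclidean 3-space. -/
abbrev R3 : Type := EuclideanSpace ℝ (Fin 3)

/-- The 3-sphere, as `ℝ³ ∪ {∞}`. -/
abbrev S3 : Type := OnePoint R3

/-- The ring whose projection is the ellipse with centre `(p, q)`. -/
def ringAt (p q : ℝ) : Set R3 :=
  {v | (v 0 - p) ^ 2 + 3 * (v 1 - q) ^ 2 = 4 ∧ v 2 = ((v 0 - p) ^ 3 - 3 * (v 0 - p)) / 2}

/-- The top, left and right rings. -/
def rings : Set R3 := ringAt 0 1 ∪ ringAt (-1) 0 ∪ ringAt 1 0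

/-- The Borromean rings, as a subset of the 3-sphere. -/
def borromeanRings : Set S3 := (fun v : R3 => (v : S3)) '' rings

/-- The complement of the Borromean rings in the 3-sphere. -/
abbrev BorromeanComplement : Type := {s : S3 // s ∉ borromeanRings}

/-! ### The arcs of the diagram and their meridian loops -/

/-- The six arcs of the diagram. The top ring consists of `a` (outside the left ellipse) and `d`
(inside it), the left ring of `b` (outside the right ellipse) and `e` (inside it), the right ring
of `c` (outside the top ellipse) and `f` (inside it). -/
inductive Arc : Type
  | a | b | c | d | e | f

/-- The base point in `ℝ³`, above the diagram. -/
noncomputable def basePoint : R3 := !₂[0, 0, 10]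

/-- The starting point of the arrow that passes below an arc; it lies outside the ring to which the
arc belongs. -/
noncomputable def Arc.start : Arc → R3
  | .a => !₂[0, 3, -2]
  | .b => !₂[-4, -1, -2]
  | .c => !₂[4, -1, -2]
  | .d => !₂[-2, -1 / 2, -2]
  | .e => !₂[2, -1 / 2, -2]
  | .f => !₂[0, 2, -2]

/-- The end point of the arrow that passes below an arc; it lies inside the ring to which the arc
belongs. Seen from above, the segment from `start` to `finish` crosses this arc once and no other
arc. -/
noncomputable def Arc.finish : Arc → R3
  | .a => !₂[0, 2, -2]
  | .b => !₂[-2, -1 / 2, -2]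
  | .c => !₂[2, -1 / 2, -2]
  | .d => !₂[-3 / 2, 1 / 2, -2]
  | .e => !₂[0, -1 / 2, -2]
  | .f => !₂[3 / 2, 1 / 2, -2]

theorem ring_height {p q : ℝ} {v : R3} (h : v ∈ ringAt p q) : -1 ≤ v 2 ∧ v 2 ≤ 1 := by
  obtain ⟨h1, h2⟩ := h
  have h3 : (v 0 - p) ^ 2 ≤ 2 ^ 2 := by nlinarith [sq_nonneg (v 1 - q)]
  have h4 := abs_le_of_sq_le_sq' h3 (by norm_num)
  rw [h2]
  constructor
  · nlinarith [mul_nonneg (by linarith : 0 ≤ v 0 - p + 2) (sq_nonneg (v 0 - p - 1))]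
  · nlinarith [mul_nonneg (by linarith : 0 ≤ 2 - (v 0 - p)) (sq_nonneg (v 0 - p + 1))]

theorem rings_height {v : R3} (h : v ∈ rings) : -1 ≤ v 2 ∧ v 2 ≤ 1 := by
  rcases h with (h | h) | h <;> exact ring_height h

theorem basePoint_notMem : basePoint ∉ rings := fun h => by
  have := rings_height h
  simp [basePoint] at this

theorem Arc.segment_start_finish (g : Arc) (t : ℝ) :
    AffineMap.lineMap g.start g.finish t ∉ rings := fun h => by
  have := rings_height h
  cases g <;> simp [Arc.start, Arc.finish, AffineMap.lineMap_apply] at this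

theorem ray_notMem (x y : ℝ)
    (h : ∀ t : ℝ, 3 / 4 ≤ t → t ≤ 11 / 12 →
      (t * x) ^ 2 + 3 * (t * y - 1) ^ 2 ≠ 4 ∧ (t * x + 1) ^ 2 + 3 * (t * y) ^ 2 ≠ 4 ∧
        (t * x - 1) ^ 2 + 3 * (t * y) ^ 2 ≠ 4) (t : ℝ) :
    AffineMap.lineMap basePoint (!₂[x, y, -2] : R3) t ∉ rings := fun hm => by
  have hz := rings_height hm
  simp [basePoint, AffineMap.lineMap_apply] at hz
  obtain ⟨h1, h2, h3⟩ := h t (by linarith) (by linarith)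
  rcases hm with (hm | hm) | hm
  · exact h1 (by simpa [basePoint, AffineMap.lineMap_apply] using hm.1)
  · exact h2 (by simpa [basePoint, AffineMap.lineMap_apply] using hm.1)
  · exact h3 (by simpa [basePoint, AffineMap.lineMap_apply] using hm.1)

theorem Arc.segment_start (g : Arc) (t : ℝ) :
    AffineMap.lineMap basePoint g.start t ∉ rings := by
  cases g <;> refine ray_notMem _ _ (fun t h1 h2 => ⟨?_, ?_, ?_⟩) t <;> intro h3 <;> nlinarith

theorem Arc.segment_finish (g : Arc) (t : ℝ) :
    AffineMap.lineMap basePoint g.finish t ∉ rings := by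
  cases g <;> refine ray_notMem _ _ (fun t h1 h2 => ⟨?_, ?_, ?_⟩) t <;> intro h3 <;> nlinarith

theorem coe_notMem {v : R3} (h : v ∉ rings) : (v : S3) ∉ borromeanRings := by
  rintro ⟨w, hw, hwv⟩
  exact h (OnePoint.coe_injective hwv ▸ hw)

/-- A point of `ℝ³` off the rings, as a point of the complement. -/
def toComplement (v : R3) (h : v ∉ rings) : BorromeanComplement := ⟨(v : S3), coe_notMem h⟩

/-- The straight path from `v` to `w`, if it misses the rings. -/
noncomputable def segmentPath (v w : R3) (hv : v ∉ rings) (hw : w ∉ rings)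
    (h : ∀ t : ℝ, AffineMap.lineMap v w t ∉ rings) :
    Path (toComplement v hv) (toComplement w hw) where
  toFun t := toComplement (AffineMap.lineMap v w (t : ℝ)) (h t)
  continuous_toFun := by
    refine Continuous.subtype_mk (OnePoint.continuous_coe.comp ?_) _
    exact AffineMap.lineMap_continuous.comp continuous_subtype_val
  source' := by simp [toComplement]
  target' := by simp [toComplement]

theorem Arc.start_notMem (g : Arc) : g.start ∉ rings := by simpa using g.segment_start 1

theorem Arc.finish_notMem (g : Arc) : g.finish ∉ rings := by simpa using g.segment_finish 1

/-- The base point of the fundamental group. -/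
noncomputable def base : BorromeanComplement := toComplement basePoint basePoint_notMem

/-- The triangular loop that goes down from the base point to the start of the arrow of an arc,
follows the arrow below the arc, and returns to the base point. -/
noncomputable def Arc.loop (g : Arc) : Path base base :=
  (segmentPath basePoint g.start basePoint_notMem g.start_notMem g.segment_start).trans
    ((segmentPath g.start g.finish g.start_notMem g.finish_notMem g.segment_start_finish).trans
      (segmentPath basePoint g.finish basePoint_notMem g.finish_notMem g.segment_finish).symm)

/-- The class of the meridian loop of an arc. In `FundamentalGroup`, the product `x * y` is
represented by a loop of the class `y` followed by a loop of the class `x`. -/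
noncomputable def Arc.meridian (g : Arc) : FundamentalGroup BorromeanComplement base :=
  FundamentalGroup.fromPath (Path.Homotopic.Quotient.mk g.loop)

/-! ### The presentations -/

namespace Wirtinger

/-- The arcs as generators of the free group. -/
abbrev gen (g : Arc) : FreeGroup Arc := FreeGroup.of g

/-- First relator. -/
def R₁ : FreeGroup Arc := (gen .d)⁻¹ * gen .b * gen .a * (gen .b)⁻¹

/-- Second relator. -/
def R₂ : FreeGroup Arc := gen .f * gen .d * (gen .c)⁻¹ * (gen .d)⁻¹

/-- Third relator. -/
def R₃ : FreeGroup Arc := gen .e * gen .f * (gen .b)⁻¹ * (gen .f)⁻¹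

/-- Fourth relator. -/
def R₄ : FreeGroup Arc := gen .f * gen .a * (gen .c)⁻¹ * (gen .a)⁻¹

/-- Fifth relator. -/
def R₅ : FreeGroup Arc := gen .e * gen .c * (gen .b)⁻¹ * (gen .c)⁻¹

/-- Sixth relator. -/
def R₆ : FreeGroup Arc := gen .d * gen .e * (gen .a)⁻¹ * (gen .e)⁻¹

/-- The set of the six relators, one for each crossing of the diagram. -/
def rels : Set (FreeGroup Arc) := {R₁, R₂, R₃, R₄, R₅, R₆}

end Wirtinger

/-- The three generators that remain. -/
inductive Gen : Type
  | a | b | c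

/-- The arc of each remaining generator. -/
def Gen.toArc : Gen → Arc
  | .a => .a
  | .b => .b
  | .c => .c

namespace Reduced

/-- The commutator `[x, y] = x⁻¹ y⁻¹ x y`. -/
def comm {G : Type*} [Group G] (x y : G) : G := x⁻¹ * y⁻¹ * x * y

/-- The remaining generators in the free group. -/
abbrev gen (g : Gen) : FreeGroup Gen := FreeGroup.of g

/-- The substitution `d = b a b⁻¹`, `e = c b c⁻¹`, `f = a c a⁻¹`. -/
def eliminate : FreeGroup Arc →* FreeGroup Gen :=
  FreeGroup.lift fun
    | .a => gen .a
    | .b => gen .b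
    | .c => gen .c
    | .d => gen .b * gen .a * (gen .b)⁻¹
    | .e => gen .c * gen .b * (gen .c)⁻¹
    | .f => gen .a * gen .c * (gen .a)⁻¹

/-- The relators `[c⁻¹, [b⁻¹, a]]` and `[b, [c, a⁻¹]]`. -/
def rels : Set (FreeGroup Gen) :=
  {comm (gen .c)⁻¹ (comm (gen .b)⁻¹ (gen .a)), comm (gen .b) (comm (gen .c) (gen .a)⁻¹)}

end Reduced

/-! The complement is covered by nine open pieces: the part above the rings, the part below them, a
neighbourhood of infinity, and a box between the two strands of each of the six crossings. Every
piece is simply connected, so the fundamental group is determined by the components of the overlaps.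
This is used in two opposite directions, which together play the role of van Kampen's theorem.

From the space to the group: a `Frame` fixes a path class from the base point to each point of each
piece, and two pieces through a common point give a transition loop, constant along paths in the
overlap. After normalization the transition between `upper` and `lower` depends only on the face of
the diagram, so it colours the eight faces by loops. In the box of a crossing each colour splits
into a factor depending on the side of the upper strand and one depending on the side of the lower
strand; this gives the Dehn relations (`Frame.isDehn_color`). A meridian is the quotient of the
colours on the two sides of its arc (`Frame.meridian_eq`), and the Dehn relations imply the
Wirtinger relators (`IsDehn.lift_eq_one`). This defines a homomorphism from the Wirtinger group that
sends arcs to meridians. It is surjective, since by subdivision every loop is a product of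
transition loops (`Frame.eq_top`, `Frame.subgroup_eq_top`).

From the group to the space: a Dehn colouring in any group `G` supplies transition functions for a
principal bundle with discrete fibre `G`, and its monodromy is a homomorphism to `G` that sends each
meridian to the quotient of the adjacent colours (`exists_hom_of_isDehn`). For the colouring by the
Wirtinger group itself (`Wirtinger.isDehn_color`) this is a left inverse of the first homomorphism,
which is therefore injective.

The reduced presentation is then algebra: `R₁`, `R₄`, `R₅` eliminate `d`, `f`, `e`; the images of
`R₂` and `R₃` are conjugate to the two commutators, and that of `R₆` follows from them. -/

open Topology

/-! ### Monodromy of a bundle glued from locally constant transition functions -/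

theorem IsCoveringMap.monodromy_mk_eq {E X : Type*} [TopologicalSpace E] [TopologicalSpace X]
    {π : E → X} (cov : IsCoveringMap π) {x y : X} {p : Path x y} {e : π ⁻¹' {x}} {e' : π ⁻¹' {y}}
    {Γ : unitInterval → E} (hΓ : Continuous Γ) (hp : ∀ t, π (Γ t) = p t) (h0 : Γ 0 = e)
    (h1 : Γ 1 = e') : cov.monodromy (.mk p) e = e' := by
  have := (cov.eq_liftPath_iff (γ := (p : C(unitInterval, X))) (e := e.1)
    (p.source.trans e.2.symm)).2 ⟨hΓ, funext hp, h0⟩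
  exact Subtype.ext ((congrFun this 1).symm.trans h1)

section Transport

variable {X G ι : Type*} [TopologicalSpace X] [Group G]

/-- The principal bundle with discrete fiber that is glued from local sections `s i`, which are
arbitrary functions whose quotients are locally constant on the overlaps. -/
@[reducible]
noncomputable def cocycleBundle [TopologicalSpace G] [DiscreteTopology G] (U : ι → Set X)
    (hU : ∀ i, IsOpen (U i)) (hcov : ∀ x, ∃ i, x ∈ U i) (s : ι → X → G)
    (hs : ∀ i j, ∀ x ∈ U i ∩ U j, ∀ᶠ y in 𝓝 x, (s i y)⁻¹ * s j y = (s i x)⁻¹ * s j x) :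
    FiberBundleCore ι X G where
  baseSet := U
  isOpen_baseSet := hU
  indexAt x := (hcov x).choose
  mem_baseSet_at x := (hcov x).choose_spec
  coordChange i j x v := (s j x)⁻¹ * s i x * v
  coordChange_self i x _ v := by simp
  continuousOn_coordChange i j := by
    rintro ⟨x, v⟩ ⟨hx, -⟩
    refine ContinuousAt.continuousWithinAt ?_
    have h1 : ContinuousAt (fun x => (s j x)⁻¹ * s i x) x :=
      continuousAt_const.congr ((hs j i x ⟨hx.2, hx.1⟩).mono fun y hy => hy.symm)
    have h2 : Filter.Tendsto (fun p : X × G => ((s j p.1)⁻¹ * s i p.1, p.2)) (𝓝 (x, v))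
        (𝓝 ((s j x)⁻¹ * s i x, v)) :=
      Filter.Tendsto.prodMk_nhds (h1.tendsto.comp continuousAt_fst) continuousAt_snd
    exact (continuous_of_discreteTopology (f := fun p : G × G =>
      p.1 * p.2)).continuousAt.tendsto.comp
      h2
  coordChange_comp i j k x _ v := by group

/-- `T` is the monodromy of the principal bundle, read in the (discontinuous) global fibre
coordinate. Coordinate changes are left multiplications, so right translations are bundle maps and
monodromy commutes with them; this makes `T` multiplicative. -/
theorem exists_transport_of_discrete [TopologicalSpace G] [DiscreteTopology G] (U : ι → Set X)
    (hU : ∀ i, IsOpen (U i)) (hcov : ∀ x, ∃ i, x ∈ U i) (s : ι → X → G)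
    (hs : ∀ i j, ∀ x ∈ U i ∩ U j, ∀ᶠ y in 𝓝 x, (s i y)⁻¹ * s j y = (s i x)⁻¹ * s j x) :
    ∃ T : ∀ x y : X, Path.Homotopic.Quotient x y → G,
      (∀ x y z p q, T x z (p.trans q) = T y z q * T x y p) ∧
      ∀ i x y (p : Path x y), (∀ t, p t ∈ U i) →
        T x y (.mk p) = s i y * (s i x)⁻¹ := by
  let Z := cocycleBundle U hU hcov s hs
  have cov : IsCoveringMap Z.proj := FiberBundle.isCoveringMap (F := G) (E := Z.Fiber)
  -- the global coordinate of a point of the bundle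
  let σ : X → G := fun x => s (Z.indexAt x) x
  let κ : ∀ x, Z.proj ⁻¹' {x} → G := fun x e => σ x * (show G from e.1.2)
  let pt : ∀ x, G → Z.proj ⁻¹' {x} := fun x g => ⟨⟨x, (σ x)⁻¹ * g⟩, rfl⟩
  have hκpt : ∀ x g, κ x (pt x g) = g := fun x g => by simp [κ, pt]
  have hptκ : ∀ x e, pt x (κ x e) = e := by
    rintro x ⟨⟨y, v⟩, rfl⟩
    exact Subtype.ext (congrArg (fun w : G => (⟨y, w⟩ : Z.TotalSpace)) (inv_mul_cancel_left _ _))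
  -- right translation
  let R : G → Z.TotalSpace → Z.TotalSpace := fun g e => ⟨e.1, (show G from e.2) * g⟩
  have hR : ∀ g, Continuous (R g) := by
    intro g
    rw [continuous_iff_continuousAt]
    intro e
    rw [FiberBundle.continuousAt_totalSpace]
    refine ⟨(FiberBundle.continuous_proj G Z.Fiber).continuousAt, ?_⟩
    have h1 : ContinuousAt
        (fun e' : Z.TotalSpace => ((trivializationAt G Z.Fiber e.proj) e').2) e :=
      ((FiberBundle.continuousAt_totalSpace G id).1 continuousAt_id).2
    have h2 := (continuous_of_discreteTopology (f := fun v : G => v * g)).continuousAt.comp h1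
    refine h2.congr (Filter.Eventually.of_forall fun e' => ?_)
    simp only [Function.comp]
    exact mul_assoc _ _ _
  -- The right translate of a lift is again a lift of the same path, so uniqueness of lifts gives
  -- equivariance.
  have equiv : ∀ {x y : X} (p : Path.Homotopic.Quotient x y) (g h : G),
      κ y (cov.monodromy p (pt x (g * h))) = κ y (cov.monodromy p (pt x g)) * h := by
    intro x y p g h
    obtain ⟨p⟩ := p
    have h0 : p 0 = Z.proj (pt x g).1 := p.source
    have hm := cov.monodromy_mk_eq (p := p) (e := pt x (g * h))
      (e' := ⟨R h (cov.liftPath p (pt x g).1 h0 1),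
        (congrFun (cov.liftPath_lifts p (pt x g).1 h0) 1).trans p.target⟩)
      (Γ := fun t => R h (cov.liftPath p (pt x g).1 h0 t))
      ((hR h).comp (cov.liftPath p (pt x g).1 h0).continuous)
      (fun t => congrFun (cov.liftPath_lifts p (pt x g).1 h0) t)
      (by
        rw [cov.liftPath_zero]
        exact congrArg (fun w : G => (⟨x, w⟩ : Z.TotalSpace)) (mul_assoc _ _ _)) rfl
    have hm' := cov.monodromy_mk_eq (p := p) (e := pt x g)
      (e' := ⟨cov.liftPath p (pt x g).1 h0 1,
        (congrFun (cov.liftPath_lifts p (pt x g).1 h0) 1).trans p.target⟩)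
      (cov.liftPath p (pt x g).1 h0).continuous
      (fun t => congrFun (cov.liftPath_lifts p (pt x g).1 h0) t) (cov.liftPath_zero ..) rfl
    refine (congrArg (κ y) hm).trans (Eq.trans ?_ (congrArg (fun e => κ y e * h) hm').symm)
    exact (mul_assoc _ _ _).symm
  refine ⟨fun x y p => κ y (cov.monodromy p (pt x 1)), ?_, ?_⟩
  · intro x y z p q
    beta_reduce
    rw [cov.monodromy_trans_apply]
    conv_lhs => rw [← hptκ y (cov.monodromy p (pt x 1)), ← one_mul (κ y _)]
    rw [equiv]
  · intro i x y p hp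
    -- In the chart `i` this lift has the constant fibre coordinate `(s i x)⁻¹`.
    have hm := cov.monodromy_mk_eq (p := p) (e := pt x 1)
      (e' := ⟨⟨y, (σ y)⁻¹ * s i y * (s i x)⁻¹⟩, rfl⟩)
      (Γ := fun t => (⟨p t, (σ (p t))⁻¹ * s i (p t) * (s i x)⁻¹⟩ : Z.TotalSpace))
      (by
        have h1 : Continuous fun t => (p t, (s i x)⁻¹) := by fun_prop
        have h2 := (Z.localTriv i).toOpenPartialHomeomorph.continuousOn_symm.comp_continuous h1
          (fun t => (Z.mem_localTriv_target i _).2 (hp t))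
        exact h2)
      (fun t => rfl)
      (by
        refine (congrArg (fun z => (⟨z, (σ z)⁻¹ * s i z * (s i x)⁻¹⟩ : Z.TotalSpace))
          p.source).trans ?_
        exact congrArg (fun w : G => (⟨x, w⟩ : Z.TotalSpace)) (by group))
      (congrArg (fun z => (⟨z, (σ z)⁻¹ * s i z * (s i x)⁻¹⟩ : Z.TotalSpace)) p.target)
    refine (congrArg (κ y) hm).trans ?_
    change σ y * ((σ y)⁻¹ * s i y * (s i x)⁻¹) = _
    group

theorem exists_transport (U : ι → Set X)
    (hU : ∀ i, IsOpen (U i)) (hcov : ∀ x, ∃ i, x ∈ U i) (s : ι → X → G)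
    (hs : ∀ i j, ∀ x ∈ U i ∩ U j, ∀ᶠ y in 𝓝 x, (s i y)⁻¹ * s j y = (s i x)⁻¹ * s j x) :
    ∃ T : ∀ x y : X, Path.Homotopic.Quotient x y → G,
      (∀ x y z p q, T x z (p.trans q) = T y z q * T x y p) ∧
      ∀ i x y (p : Path x y), (∀ t, p t ∈ U i) →
        T x y (.mk p) = s i y * (s i x)⁻¹ :=
  letI : TopologicalSpace G := ⊥
  haveI : DiscreteTopology G := ⟨rfl⟩
  exists_transport_of_discrete U hU hcov s hs

end Transport

/-! ### Generation of the fundamental group by transition loops -/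

section Frame

variable {X ι : Type*} [TopologicalSpace X] {b : X}

theorem IsSimplyConnected.mk_eq_mk {S : Set X} (hS : IsSimplyConnected S) {x y : X}
    (p q : Path x y) (hp : ∀ t, p t ∈ S) (hq : ∀ t, q t ∈ S) :
    Path.Homotopic.Quotient.mk p = Path.Homotopic.Quotient.mk q := by
  have := hS.simplyConnectedSpace
  have hx : x ∈ S := by simpa using hp 0
  have hy : y ∈ S := by simpa using hp 1
  let p' : Path (⟨x, hx⟩ : S) ⟨y, hy⟩ :=
    ⟨⟨fun t => ⟨p t, hp t⟩, by fun_prop⟩, by simp, by simp⟩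
  let q' : Path (⟨x, hx⟩ : S) ⟨y, hy⟩ :=
    ⟨⟨fun t => ⟨q t, hq t⟩, by fun_prop⟩, by simp, by simp⟩
  have h := SimplyConnectedSpace.paths_homotopic p' q'
  exact Path.Homotopic.Quotient.eq.2 (h.map ⟨Subtype.val, continuous_subtype_val⟩)

/-- A path class from the base point to each point of a simply connected set, compatible with the
paths in this set. -/
theorem IsSimplyConnected.exists_frame {S : Set X} (hS : IsSimplyConnected S) {x₀ : X}
    (hx₀ : x₀ ∈ S) (β : Path.Homotopic.Quotient b x₀) :
    ∃ Γ : ∀ x ∈ S, Path.Homotopic.Quotient b x, Γ x₀ hx₀ = β ∧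
      ∀ x y hx hy (p : Path x y), (∀ t, p t ∈ S) → (Γ x hx).trans (.mk p) = Γ y hy := by
  choose p hp using fun x (hx : x ∈ S) => hS.isPathConnected.joinedIn x₀ hx₀ x hx
  refine ⟨fun x hx => β.trans (.mk (p x hx)), ?_, ?_⟩
  · beta_reduce
    rw [hS.mk_eq_mk (p x₀ hx₀) (Path.refl x₀) (hp x₀ hx₀) (fun _ => hx₀)]
    simp
  · intro x y hx hy q hq
    rw [Path.Homotopic.Quotient.trans_assoc, ← Path.Homotopic.Quotient.mk_trans,
      hS.mk_eq_mk ((p x hx).trans q) (p y hy) _ (hp y hy)]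
    intro t
    rw [Path.trans_apply]
    split_ifs
    · exact hp x hx _
    · exact hq _

/-- Path classes from the base point to the points of the sets `U i`, compatible with the paths
in each set. -/
structure Frame (b : X) (U : ι → Set X) where
  toPath : ∀ i, ∀ x ∈ U i, Path.Homotopic.Quotient b x
  toPath_trans : ∀ i x y hx hy (p : Path x y), (∀ t, p t ∈ U i) →
    (toPath i x hx).trans (.mk p) = toPath i y hy

namespace Frame

variable {U : ι → Set X} (Γ : Frame b U)

/-- The loop that runs to `x` through `U j` and returns through `U i`. -/
noncomputable def g (i j : ι) (x : X) (hi : x ∈ U i) (hj : x ∈ U j) : FundamentalGroup X b :=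
  FundamentalGroup.fromPath ((Γ.toPath j x hj).trans (Γ.toPath i x hi).symm)

theorem g_self (i : ι) (x : X) (hi : x ∈ U i) : Γ.g i i x hi hi = 1 :=
  Path.Homotopic.Quotient.trans_symm _

theorem g_mul (i j k : ι) (x : X) (hi : x ∈ U i) (hj : x ∈ U j) (hk : x ∈ U k) :
    Γ.g i j x hi hj * Γ.g j k x hj hk = Γ.g i k x hi hk := by
  rw [FundamentalGroup.mul_def]
  simp only [g]
  rw [Path.Homotopic.Quotient.trans_assoc,
    ← Path.Homotopic.Quotient.trans_assoc (Γ.toPath j x hj).symm]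
  simp

theorem g_inv (i j : ι) (x : X) (hi : x ∈ U i) (hj : x ∈ U j) :
    (Γ.g i j x hi hj)⁻¹ = Γ.g j i x hj hi := by
  rw [inv_eq_iff_mul_eq_one, g_mul, g_self]

theorem trans_symm_of_path {i : ι} {x y : X} (hx : x ∈ U i) (hy : y ∈ U i) (p : Path x y)
    (hp : ∀ t, p t ∈ U i) :
    (Path.Homotopic.Quotient.mk p).trans (Γ.toPath i y hy).symm = (Γ.toPath i x hx).symm := by
  have h := Γ.toPath_trans i x y hx hy p hp
  rw [← Path.Homotopic.Quotient.refl_trans ((Path.Homotopic.Quotient.mk p).trans _),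
    ← Path.Homotopic.Quotient.symm_trans (Γ.toPath i x hx), Path.Homotopic.Quotient.trans_assoc,
    ← Path.Homotopic.Quotient.trans_assoc (Γ.toPath i x hx), h,
    Path.Homotopic.Quotient.trans_symm, Path.Homotopic.Quotient.trans_refl]

/-- A path inside the overlap can be inserted into both halves of the loop, where it cancels. Hence
there is one transition element for each path component of an overlap. -/
theorem g_eq_of_joinedIn {i j : ι} {x y : X} (h : JoinedIn (U i ∩ U j) x y) :
    Γ.g i j x h.source_mem.1 h.source_mem.2 = Γ.g i j y h.target_mem.1 h.target_mem.2 := by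
  obtain ⟨p, hp⟩ := h
  simp only [g]
  rw [← Γ.toPath_trans j x y (by simpa using (hp 0).2) (by simpa using (hp 1).2) p
    fun t => (hp t).2, Path.Homotopic.Quotient.trans_assoc, Γ.trans_symm_of_path _ _ p
    fun t => (hp t).1]

/-- The class of a path, closed up by the frame, is in `H`. -/
def Good (H : Subgroup (FundamentalGroup X b)) {x y : X} (p : Path.Homotopic.Quotient x y) : Prop :=
  ∀ i j hx hy, FundamentalGroup.fromPath
    (((Γ.toPath i x hx).trans p).trans (Γ.toPath j y hy).symm) ∈ H

variable {Γ} {H : Subgroup (FundamentalGroup X b)}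

theorem Good.trans (hcov : ∀ x, ∃ i, x ∈ U i) {x y z : X} {p : Path.Homotopic.Quotient x y}
    {q : Path.Homotopic.Quotient y z} (hp : Γ.Good H p) (hq : Γ.Good H q) :
    Γ.Good H (p.trans q) := by
  intro i k hx hz
  obtain ⟨j, hy⟩ := hcov y
  have h := H.mul_mem (hq j k hy hz) (hp i j hx hy)
  rw [FundamentalGroup.mul_def] at h
  convert h using 1
  simp only [Path.Homotopic.Quotient.trans_assoc]
  rw [← Path.Homotopic.Quotient.trans_assoc (Γ.toPath j y hy).symm]
  simp

/-- Inside `U i` the path is the difference of two frame paths, so the closed-up class is the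
product of a transition at `y` and a transition at `x`. -/
theorem good_of_mem (hH : ∀ i j x hi hj, Γ.g i j x hi hj ∈ H) {i : ι} {x y : X} (p : Path x y)
    (hp : ∀ t, p t ∈ U i) : Γ.Good H (.mk p) := by
  intro j k hx hy
  have hix : x ∈ U i := by simpa using hp 0
  have hiy : y ∈ U i := by simpa using hp 1
  have h := H.mul_mem (hH k i y hy hiy) (hH i j x hix hx)
  rw [FundamentalGroup.mul_def] at h
  convert h using 1
  simp only [g]
  rw [Path.Homotopic.Quotient.trans_assoc, Path.Homotopic.Quotient.trans_assoc,
    ← Γ.toPath_trans i x y hix hiy p hp]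
  congr 1
  simp only [← Path.Homotopic.Quotient.trans_assoc]
  simp

theorem good_cast {x y x' y' : X} (hx : x' = x) (hy : y' = y) (p : Path x y)
    (h : Γ.Good H (.mk (p.cast hx hy))) : Γ.Good H (.mk p) := by
  subst hx hy
  exact h

/-- By compactness of the interval the path is a finite concatenation of paths that each stay in one
set of the cover. -/
theorem good_all (hU : ∀ i, IsOpen (U i)) (hcov : ∀ x, ∃ i, x ∈ U i)
    (hH : ∀ i j x hi hj, Γ.g i j x hi hj ∈ H) {x y : X} (p : Path x y) : Γ.Good H (.mk p) := by
  obtain ⟨t, t_zero, t_mono, ⟨n, hn⟩, ht⟩ := exists_monotone_Icc_subset_open_cover_unitInterval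
    (fun i => (hU i).preimage p.continuous)
    (fun t _ => Set.mem_iUnion.2 (hcov (p t)))
  have key : ∀ n, Γ.Good H (.mk (p.subpath 0 (t n))) := by
    intro n
    induction n with
    | zero =>
      obtain ⟨i, hi⟩ := hcov (p 0)
      refine good_of_mem hH (i := i) _ fun s => ?_
      have : p.subpath 0 (t 0) s ∈ Set.range (p.subpath 0 (t 0)) := ⟨s, rfl⟩
      rw [Path.range_subpath] at this
      obtain ⟨r, hr, hrs⟩ := this
      rw [t_zero, Set.uIcc_self, Set.mem_singleton_iff] at hr
      rw [← hrs, hr]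
      exact hi
    | succ n ih =>
      obtain ⟨i, hi⟩ := ht n
      have h2 : Γ.Good H (.mk (p.subpath (t n) (t (n + 1)))) := by
        refine good_of_mem hH (i := i) _ fun s => ?_
        have : p.subpath (t n) (t (n + 1)) s ∈ Set.range (p.subpath (t n) (t (n + 1))) := ⟨s, rfl⟩
        rw [Path.range_subpath_of_le _ _ _ (t_mono n.le_succ)] at this
        obtain ⟨r, hr, hrs⟩ := this
        rw [← hrs]
        exact hi hr
      have h3 := Good.trans hcov ih h2
      rwa [← Path.Homotopic.Quotient.mk_trans,
        Path.Homotopic.Quotient.eq.2 ⟨Path.Homotopy.subpathTransSubpath p 0 (t n) (t (n + 1))⟩]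
        at h3
  have h1 := key n
  rw [hn n le_rfl, Path.subpath_zero_one] at h1
  exact good_cast _ _ _ h1

/-- As the frame is trivial at the base point, closing up a loop does not change its class. -/
theorem eq_top (hU : ∀ i, IsOpen (U i)) (hcov : ∀ x, ∃ i, x ∈ U i)
    (hH : ∀ i j x hi hj, Γ.g i j x hi hj ∈ H) {i : ι} (hi : b ∈ U i)
    (hb : Γ.toPath i b hi = .refl b) : H = ⊤ := by
  rw [Subgroup.eq_top_iff']
  intro p
  induction p using Path.Homotopic.Quotient.ind with | mk p =>
  have := good_all (Γ := Γ) hU hcov hH p i i hi hi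
  have h1 : (Path.Homotopic.Quotient.refl b).symm = .refl b :=
    (Path.Homotopic.Quotient.refl_trans _).symm.trans (Path.Homotopic.Quotient.trans_symm _)
  rwa [hb, h1, Path.Homotopic.Quotient.refl_trans, Path.Homotopic.Quotient.trans_refl] at this

end Frame

end Frame

/-! ### The pieces of the complement -/

/-- The three rings. -/
inductive RingIdx : Type
  | top | left | right

namespace RingIdx

instance : Finite RingIdx :=
  Set.finite_univ_iff.1 ((Set.toFinite {top, left, right}).subset fun r _ => by cases r <;> simp)

/-- First coordinate of the centre of the ellipse. -/
def cx : RingIdx → ℝ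
  | top => 0
  | left => -1
  | right => 1

/-- Second coordinate of the centre of the ellipse. -/
def cy : RingIdx → ℝ
  | top => 1
  | left => 0
  | right => 0

/-- The ring that passes below the given one. -/
def under : RingIdx → RingIdx
  | top => right
  | left => top
  | right => left

/-- The ring that passes above the given one. -/
def third : RingIdx → RingIdx
  | top => left
  | left => right
  | right => top

/-- First coordinate of the crossing of a ring over the next one, inside or outside the third. -/
def crossX : RingIdx → Bool → ℝ
  | top, true => -1
  | top, false => 2
  | left, true => 1
  | left, false => -2
  | right, _ => 0

/-- Second coordinate of the crossing of a ring over the next one, inside or outside the third. -/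
def crossY : RingIdx → Bool → ℝ
  | top, true => 0
  | top, false => 1
  | left, true => 0
  | left, false => 1
  | right, true => 1
  | right, false => -1

/-- The quadratic form that is equal to `4` on the ellipse. -/
def ell (r : RingIdx) (v : R3) : ℝ := (v 0 - r.cx) ^ 2 + 3 * (v 1 - r.cy) ^ 2

/-- The height of the ring, as a function on the plane. -/
noncomputable def height (r : RingIdx) (v : R3) : ℝ :=
  ((v 0 - r.cx) ^ 3 - 3 * (v 0 - r.cx)) / 2

theorem continuous_ell (r : RingIdx) : Continuous r.ell := by unfold ell; fun_prop

theorem continuous_height (r : RingIdx) : Continuous r.height := by unfold height; fun_prop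

theorem forall_iff (r : RingIdx) {p : RingIdx → Prop} :
    (∀ s, p s) ↔ p r ∧ p r.under ∧ p r.third := by
  refine ⟨fun h => ⟨h _, h _, h _⟩, ?_⟩
  rintro ⟨h1, h2, h3⟩ (_ | _ | _) <;> cases r <;> assumption

end RingIdx

open RingIdx

theorem mem_rings_iff {v : R3} : v ∈ rings ↔ ∃ r : RingIdx, r.ell v = 4 ∧ v 2 = r.height v := by
  constructor
  · rintro ((h | h) | h)
    · exact ⟨.top, h⟩
    · exact ⟨.left, h⟩
    · exact ⟨.right, h⟩
  · rintro ⟨_ | _ | _, h⟩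
    · exact Or.inl (Or.inl h)
    · exact Or.inl (Or.inr h)
    · exact Or.inr h

theorem RingIdx.abs_sub_cx_le {r : RingIdx} {v : R3} (h : r.ell v = 4) : |v 0 - r.cx| ≤ 2 := by
  unfold ell at h
  exact abs_le_of_sq_le_sq (by nlinarith [sq_nonneg (v 1 - r.cy)]) (by norm_num)

theorem RingIdx.height_bounds {r : RingIdx} {v : R3} (h : r.ell v = 4) :
    -1 ≤ r.height v ∧ r.height v ≤ 1 := by
  obtain ⟨h4, h5⟩ := abs_le.1 (abs_sub_cx_le h)
  unfold height
  constructor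
  · nlinarith [mul_nonneg (by linarith : 0 ≤ v 0 - r.cx + 2) (sq_nonneg (v 0 - r.cx - 1))]
  · nlinarith [mul_nonneg (by linarith : 0 ≤ 2 - (v 0 - r.cx)) (sq_nonneg (v 0 - r.cx + 1))]

/-- Lipschitz bound for the height of a ring; the best constant is `9 / 2`. It is the source of the
slope `5` in the boxes `mid r t`: a strand through height `±1` at the crossing cannot enter a box
that narrows at this rate. -/
theorem abs_cubic_sub_le {u w : ℝ} (hu : |u| ≤ 2) (hw : |w| ≤ 2) :
    |(u ^ 3 - 3 * u) / 2 - (w ^ 3 - 3 * w) / 2| ≤ 5 * |u - w| := by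
  obtain ⟨h1, h2⟩ := abs_le.1 hu
  obtain ⟨h3, h4⟩ := abs_le.1 hw
  have h : (u ^ 3 - 3 * u) / 2 - (w ^ 3 - 3 * w) / 2 =
      (u ^ 2 + u * w + w ^ 2 - 3) / 2 * (u - w) := by ring
  rw [h, abs_mul]
  refine mul_le_mul_of_nonneg_right (abs_le.2 ⟨?_, ?_⟩) (abs_nonneg _)
  · nlinarith [sq_nonneg (u + w)]
  · nlinarith [sq_nonneg (u - w)]

/-- Index set of the open cover of the complement: the part above the rings, the part below the
rings, a neighbourhood of infinity, and the six regions between the strands of a crossing. -/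
inductive Piece : Type
  | upper | lower | outer
  | mid (r : RingIdx) (t : Bool)

namespace Piece

/-- The finite points of a piece. -/
def fin : Piece → Set R3
  | upper => {v | -3 < v 2 ∧ ∀ r : RingIdx, r.ell v = 4 → r.height v < v 2}
  | lower => {v | v 2 < 3 ∧ ∀ r : RingIdx, r.ell v = 4 → v 2 < r.height v}
  | outer => {v | ∃ i, 5 < |v i|}
  | mid r t => {v | |v 1 - r.crossY t| < 1 / 8 ∧ |v 2| + 5 * |v 0 - r.crossX t| < 1}

theorem mid_over {r : RingIdx} {t : Bool} {v : R3} (hv : v ∈ (mid r t).fin) (h : r.ell v = 4) :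
    v 2 < r.height v := by
  obtain ⟨h1, h2⟩ := hv
  have h3 := abs_cubic_sub_le (abs_sub_cx_le h) (w := r.crossX t - r.cx) (by
    cases r <;> cases t <;> norm_num [crossX, cx])
  have h4 := (abs_le.1 h3).1
  have h5 : ((r.crossX t - r.cx) ^ 3 - 3 * (r.crossX t - r.cx)) / 2 = 1 := by
    cases r <;> cases t <;> norm_num [crossX, cx]
  rw [h5, sub_sub_sub_cancel_right] at h4
  have := le_abs_self (v 2)
  unfold height
  linarith

theorem mid_under {r : RingIdx} {t : Bool} {v : R3} (hv : v ∈ (mid r t).fin)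
    (h : r.under.ell v = 4) : r.under.height v < v 2 := by
  obtain ⟨h1, h2⟩ := hv
  have h3 := abs_cubic_sub_le (abs_sub_cx_le h) (w := r.crossX t - r.under.cx) (by
    cases r <;> cases t <;> norm_num [crossX, cx, RingIdx.under])
  have h4 := (abs_le.1 h3).2
  have h5 : ((r.crossX t - r.under.cx) ^ 3 - 3 * (r.crossX t - r.under.cx)) / 2 = -1 := by
    cases r <;> cases t <;> norm_num [crossX, cx, RingIdx.under]
  rw [h5, sub_sub_sub_cancel_right] at h4
  have := neg_abs_le (v 2)
  unfold height
  linarith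

theorem mid_bounds {r : RingIdx} {t : Bool} {v : R3} (hv : v ∈ (mid r t).fin) :
    (|v 0 - r.crossX t| < 1 / 5 ∧ |v 1 - r.crossY t| < 1 / 8) ∧ |v 2| < 1 := by
  obtain ⟨h1, h2⟩ := hv
  have := abs_nonneg (v 2)
  have := abs_nonneg (v 0 - r.crossX t)
  exact ⟨⟨by linarith, h1⟩, by linarith⟩

theorem mid_third_true {r : RingIdx} {v : R3} (hv : v ∈ (mid r true).fin) : r.third.ell v < 4 := by
  obtain ⟨⟨h1, h2⟩, -⟩ := mid_bounds hv
  rw [abs_lt] at h1 h2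
  unfold ell
  cases r <;> simp only [crossX, crossY, third, cx, cy] at * <;> nlinarith

theorem mid_third_false {r : RingIdx} {v : R3} (hv : v ∈ (mid r false).fin) :
    4 < r.third.ell v := by
  obtain ⟨⟨h1, h2⟩, -⟩ := mid_bounds hv
  rw [abs_lt] at h1 h2
  unfold ell
  cases r <;> simp only [crossX, crossY, third, cx, cy] at * <;> nlinarith

theorem mid_third_ne {r : RingIdx} {t : Bool} {v : R3} (hv : v ∈ (mid r t).fin) :
    r.third.ell v ≠ 4 := by
  cases t
  · exact (mid_third_false hv).ne'
  · exact (mid_third_true hv).ne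

/-- A box lies above the lower strand and misses the third cylinder, so only the cylinder over the
upper ring can obstruct. Together with `ell_ne_of_upper_mid`, the overlap of `upper` with a box is
the box cut along this cylinder; for `lower` it is the cylinder over the lower ring. -/
theorem mem_upper_of_mid {r : RingIdx} {t : Bool} {v : R3} (hv : v ∈ (mid r t).fin)
    (h : r.ell v ≠ 4) : v ∈ upper.fin := by
  refine ⟨?_, (forall_iff r).2 ⟨fun h' => (h h').elim, mid_under hv,
    fun h' => (mid_third_ne hv h').elim⟩⟩
  have := (abs_lt.1 (mid_bounds hv).2).1
  linarith

theorem mem_lower_of_mid {r : RingIdx} {t : Bool} {v : R3} (hv : v ∈ (mid r t).fin)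
    (h : r.under.ell v ≠ 4) : v ∈ lower.fin := by
  refine ⟨?_, (forall_iff r).2 ⟨mid_over hv, fun h' => (h h').elim,
    fun h' => (mid_third_ne hv h').elim⟩⟩
  have := (abs_lt.1 (mid_bounds hv).2).2
  linarith

theorem ell_ne_of_upper_mid {r : RingIdx} {t : Bool} {v : R3} (hv : v ∈ upper.fin)
    (hv' : v ∈ (mid r t).fin) : r.ell v ≠ 4 :=
  fun h => lt_asymm (hv.2 r h) (mid_over hv' h)

theorem ell_ne_of_lower_mid {r : RingIdx} {t : Bool} {v : R3} (hv : v ∈ lower.fin)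
    (hv' : v ∈ (mid r t).fin) : r.under.ell v ≠ 4 :=
  fun h => lt_asymm (hv.2 r.under h) (mid_under hv' h)

theorem ell_ne_of_upper_lower {v : R3} (hv : v ∈ upper.fin) (hv' : v ∈ lower.fin) (r : RingIdx) :
    r.ell v ≠ 4 :=
  fun h => lt_asymm (hv.2 r h) (hv'.2 r h)

theorem mem_upper_of_ne {v : R3} (h1 : -3 < v 2) (h : ∀ r : RingIdx, r.ell v ≠ 4) :
    v ∈ upper.fin := ⟨h1, fun r hr => (h r hr).elim⟩

theorem mem_lower_of_ne {v : R3} (h1 : v 2 < 3) (h : ∀ r : RingIdx, r.ell v ≠ 4) :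
    v ∈ lower.fin := ⟨h1, fun r hr => (h r hr).elim⟩

theorem ell_gt_of_far {v : R3} (h : 5 < |v 0| ∨ 5 < |v 1|) (r : RingIdx) : 4 < r.ell v := by
  unfold ell
  rcases h with h | h <;> rw [lt_abs] at h <;> rcases h with h | h <;> cases r <;>
    simp only [cx, cy] <;>
    nlinarith [sq_nonneg (v 0), sq_nonneg (v 1), sq_nonneg (v 0 - 1), sq_nonneg (v 0 + 1), sq_nonneg (v 1 - 1)]

theorem notMem_rings_of_mem {i : Piece} {v : R3} (hv : v ∈ i.fin) : v ∉ rings := by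
  rw [mem_rings_iff]
  rintro ⟨s, h1, h2⟩
  cases i with
  | upper => exact absurd (hv.2 s h1) (by simp [h2])
  | lower => exact absurd (hv.2 s h1) (by simp [h2])
  | outer =>
    obtain ⟨i, hi⟩ := hv
    have h3 := height_bounds h1
    fin_cases i
    · exact (ell_gt_of_far (Or.inl hi) s).ne' h1
    · exact (ell_gt_of_far (Or.inr hi) s).ne' h1
    · rw [← h2, ← abs_le] at h3
      exact absurd (hi.trans_le h3) (by norm_num)
  | mid r t =>
    revert s
    rw [forall_iff r]
    exact ⟨fun h1 h2 => (mid_over hv h1).ne h2, fun h1 h2 => (mid_under hv h1).ne' h2,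
      fun h1 _ => mid_third_ne hv h1⟩

theorem isOpen_fin (i : Piece) : IsOpen i.fin := by
  have h2 : Continuous fun v : R3 => v 2 := by fun_prop
  cases i with
  | upper =>
    have : upper.fin = {v | -3 < v 2} ∩
        ⋂ r : RingIdx, ({v : R3 | r.ell v = 4} ∩ {v | v 2 ≤ r.height v})ᶜ := by
      ext v
      simp [fin]
    rw [this]
    exact (isOpen_lt continuous_const h2).inter (isOpen_iInter_of_finite fun r =>
      ((isClosed_eq r.continuous_ell continuous_const).inter
        (isClosed_le h2 r.continuous_height)).isOpen_compl)
  | lower =>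
    have : lower.fin = {v | v 2 < 3} ∩
        ⋂ r : RingIdx, ({v : R3 | r.ell v = 4} ∩ {v | r.height v ≤ v 2})ᶜ := by
      ext v
      simp [fin]
    rw [this]
    exact (isOpen_lt h2 continuous_const).inter (isOpen_iInter_of_finite fun r =>
      ((isClosed_eq r.continuous_ell continuous_const).inter
        (isClosed_le r.continuous_height h2)).isOpen_compl)
  | outer =>
    have : outer.fin = ⋃ i, {v : R3 | 5 < |v i|} := by ext; simp [fin]
    rw [this]
    exact isOpen_iUnion fun i => isOpen_lt continuous_const (by fun_prop)
  | mid r t =>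
    have h0 : Continuous fun v : R3 => |v 2| + 5 * |v 0 - r.crossX t| := by fun_prop
    have h1 : Continuous fun v : R3 => |v 1 - r.crossY t| := by fun_prop
    exact (isOpen_lt h1 continuous_const).inter (isOpen_lt h0 continuous_const)

theorem top_left_crossing {v : R3} (h1 : RingIdx.top.ell v = 4) (h2 : RingIdx.left.ell v = 4) :
    (v 0 = 1 ∧ v 1 = 0) ∨ (v 0 = -2 ∧ v 1 = 1) := by
  simp only [ell, cx, cy] at h1 h2
  -- The two forms have the same quadratic part, so their difference is the equation of the common
  -- chord.
  have h3 : v 0 = 1 - 3 * v 1 := by linarith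
  rw [h3] at h1 ⊢
  have h4 : v 1 * (v 1 - 1) = 0 := by linarith
  rcases mul_eq_zero.1 h4 with h | h
  · exact Or.inl ⟨by linarith, h⟩
  · exact Or.inr ⟨by linarith, by linarith⟩

theorem top_right_crossing {v : R3} (h1 : RingIdx.top.ell v = 4) (h2 : RingIdx.right.ell v = 4) :
    (v 0 = -1 ∧ v 1 = 0) ∨ (v 0 = 2 ∧ v 1 = 1) := by
  simp only [ell, cx, cy] at h1 h2
  have h3 : v 0 = 3 * v 1 - 1 := by linarith
  rw [h3] at h1 ⊢
  have h4 : v 1 * (v 1 - 1) = 0 := by linarith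
  rcases mul_eq_zero.1 h4 with h | h
  · exact Or.inl ⟨by linarith, h⟩
  · exact Or.inr ⟨by linarith, by linarith⟩

theorem left_right_crossing {v : R3} (h1 : RingIdx.left.ell v = 4) (h2 : RingIdx.right.ell v = 4) :
    (v 0 = 0 ∧ v 1 = 1) ∨ (v 0 = 0 ∧ v 1 = -1) := by
  simp only [ell, cx, cy] at h1 h2
  have h3 : v 0 = 0 := by linarith
  rw [h3] at h1 ⊢
  have h4 : (v 1 - 1) * (v 1 + 1) = 0 := by linarith
  rcases mul_eq_zero.1 h4 with h | h
  · exact Or.inl ⟨rfl, by linarith⟩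
  · exact Or.inr ⟨rfl, by linarith⟩

theorem exists_crossing {r s : RingIdx} {v : R3} (hr : r.ell v = 4) (hs : s.ell v = 4)
    (h : s.height v < r.height v) :
    ∃ t, v 0 = r.crossX t ∧ v 1 = r.crossY t ∧ s.height v = -1 ∧ r.height v = 1 := by
  unfold height at *
  cases r <;> cases s
  any_goals exact absurd h (lt_irrefl _)
  · rcases top_left_crossing hr hs with ⟨h1, h2⟩ | ⟨h1, h2⟩ <;> norm_num [h1, cx] at h
  · rcases top_right_crossing hr hs with ⟨h1, h2⟩ | ⟨h1, h2⟩
    · exact ⟨true, by norm_num [h1, h2, cx, crossX, crossY]⟩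
    · exact ⟨false, by norm_num [h1, h2, cx, crossX, crossY]⟩
  · rcases top_left_crossing hs hr with ⟨h1, h2⟩ | ⟨h1, h2⟩
    · exact ⟨true, by norm_num [h1, h2, cx, crossX, crossY]⟩
    · exact ⟨false, by norm_num [h1, h2, cx, crossX, crossY]⟩
  · rcases left_right_crossing hr hs with ⟨h1, h2⟩ | ⟨h1, h2⟩ <;> norm_num [h1, cx] at h
  · rcases top_right_crossing hs hr with ⟨h1, h2⟩ | ⟨h1, h2⟩ <;> norm_num [h1, cx] at h
  · rcases left_right_crossing hs hr with ⟨h1, h2⟩ | ⟨h1, h2⟩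
    · exact ⟨true, by norm_num [h1, h2, cx, crossX, crossY]⟩
    · exact ⟨false, by norm_num [h1, h2, cx, crossX, crossY]⟩

/-- A point neither above nor below the rings lies under one strand and over another on the same
vertical line, hence on the vertical line of a crossing, strictly between the strands. -/
theorem exists_mem_fin {v : R3} (hv : v ∉ rings) : ∃ i : Piece, v ∈ i.fin := by
  by_cases h1 : v ∈ upper.fin
  · exact ⟨_, h1⟩
  by_cases h2 : v ∈ lower.fin
  · exact ⟨_, h2⟩
  by_cases h3 : v 2 ≤ -3
  · exact absurd ⟨by linarith, fun r hr => by linarith [(height_bounds hr).1]⟩ h2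
  by_cases h4 : 3 ≤ v 2
  · exact absurd ⟨by linarith, fun r hr => by linarith [(height_bounds hr).2]⟩ h1
  push Not at h3 h4
  have h5 : ∃ r : RingIdx, r.ell v = 4 ∧ v 2 ≤ r.height v := by
    by_contra! h
    exact h1 ⟨h3, h⟩
  have h6 : ∃ r : RingIdx, r.ell v = 4 ∧ r.height v ≤ v 2 := by
    by_contra! h
    exact h2 ⟨h4, h⟩
  obtain ⟨r, hr, hr'⟩ := h5
  obtain ⟨s, hs, hs'⟩ := h6
  rw [mem_rings_iff] at hv
  push Not at hv
  have hr'' := lt_of_le_of_ne hr' (hv r hr)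
  have hs'' := lt_of_le_of_ne hs' (hv s hs).symm
  obtain ⟨t, h7, h8, h9, h10⟩ := exists_crossing hr hs (hs''.trans hr'')
  refine ⟨mid r t, ?_, ?_⟩
  · rw [h8, sub_self, abs_zero]
    norm_num
  · rw [h7, sub_self, abs_zero, mul_zero, add_zero, abs_lt]
    constructor <;> linarith

end Piece

/-! ### Simple connectedness of the pieces -/

theorem isSimplyConnected_of_nullhomotopic {X : Type*} [TopologicalSpace X] {S : Set X}
    (h : (ContinuousMap.id S).Nullhomotopic) : IsSimplyConnected S := by
  have := (contractible_iff_id_nullhomotopic S).2 h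
  exact (inferInstance : SimplyConnectedSpace S)

/-- A set that can be pushed into a convex subset along a fixed direction is simply connected. -/
theorem isSimplyConnected_of_translate {E : Type*} [AddCommGroup E] [Module ℝ E]
    [TopologicalSpace E] [IsTopologicalAddGroup E] [ContinuousSMul ℝ E] {A K : Set E}
    (hK : Convex ℝ K) (hKne : K.Nonempty) (hKA : K ⊆ A) (e : E)
    (hA : ∀ v ∈ A, ∀ t : ℝ, 0 ≤ t → v + t • e ∈ A) (heK : ∀ v ∈ A, v + e ∈ K) :
    IsSimplyConnected A := by
  obtain ⟨k, hk⟩ := hKne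
  let f : C(A, A) := ⟨fun v => ⟨v.1 + e, hKA (heK v.1 v.2)⟩, by fun_prop⟩
  have h1 : (ContinuousMap.id A).Homotopic f := ⟨
    { toFun := fun p => ⟨p.2.1 + (p.1 : ℝ) • e, hA _ p.2.2 _ p.1.2.1⟩
      continuous_toFun := by fun_prop
      map_zero_left := fun v => by simp
      map_one_left := fun v => by simp [f] }⟩
  have h2 : f.Homotopic (ContinuousMap.const A ⟨k, hKA hk⟩) := ⟨
    { toFun := fun p => ⟨(1 - (p.1 : ℝ)) • (p.2.1 + e) + (p.1 : ℝ) • k,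
        hKA (hK (heK _ p.2.2) hk (by linarith [p.1.2.2]) p.1.2.1 (by ring))⟩
      continuous_toFun := by fun_prop
      map_zero_left := fun v => by simp [f]
      map_one_left := fun v => by simp }⟩
  exact isSimplyConnected_of_nullhomotopic ⟨_, h1.trans h2⟩

theorem Convex.isSimplyConnected {E : Type*} [AddCommGroup E] [Module ℝ E]
    [TopologicalSpace E] [IsTopologicalAddGroup E] [ContinuousSMul ℝ E] {A : Set E}
    (hA : Convex ℝ A) (hne : A.Nonempty) : IsSimplyConnected A :=
  isSimplyConnected_of_translate hA hne subset_rfl 0 (fun v hv t _ => by simpa) (by simp)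

section Inversion

variable {E : Type*} [NormedAddCommGroup E] [NormedSpace ℝ E]

theorem norm_inv_sq_smul (v : E) : ‖(‖v‖ ^ 2)⁻¹ • v‖ = ‖v‖⁻¹ := by
  rw [norm_smul, norm_inv, norm_pow, norm_norm]
  rcases eq_or_ne ‖v‖ 0 with h | h
  · simp [h]
  · field_simp

open Classical in
/-- Inversion, from the space to its one-point compactification. -/
noncomputable def invToOnePoint (w : E) : OnePoint E :=
  if w = 0 then OnePoint.infty else (((‖w‖ ^ 2)⁻¹ • w : E) : OnePoint E)

/-- Inversion, from the one-point compactification to the space. -/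
noncomputable def invOfOnePoint (s : OnePoint E) : E :=
  s.elim 0 fun v => (‖v‖ ^ 2)⁻¹ • v

theorem continuous_invToOnePoint [ProperSpace E] : Continuous (invToOnePoint : E → OnePoint E) := by
  rw [continuous_iff_continuousAt]
  intro w
  by_cases hw : w = 0
  · subst hw
    rw [continuousAt_iff_punctured_nhds]
    have h1 : Filter.Tendsto (fun w : E => (‖w‖ ^ 2)⁻¹ • w) (𝓝[≠] 0)
        (Filter.coclosedCompact E) := by
      rw [Filter.coclosedCompact_eq_cocompact, ← Metric.cobounded_eq_cocompact,
        ← tendsto_norm_atTop_iff_cobounded]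
      simp only [norm_inv_sq_smul]
      exact tendsto_inv_nhdsGT_zero.comp tendsto_norm_nhdsNE_zero
    have h2 : invToOnePoint (0 : E) = OnePoint.infty := by simp [invToOnePoint]
    rw [h2]
    refine (OnePoint.tendsto_coe_infty.comp h1).congr' ?_
    filter_upwards [self_mem_nhdsWithin] with w hw
    simp only [Function.comp]
    rw [invToOnePoint, if_neg (show w ≠ 0 from hw)]
  · have h1 : ContinuousAt (fun w : E => (((‖w‖ ^ 2)⁻¹ • w : E) : OnePoint E)) w := by
      refine OnePoint.continuous_coe.continuousAt.comp ?_
      have : ‖w‖ ^ 2 ≠ 0 := by simpa using hw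
      fun_prop (disch := assumption)
    refine h1.congr ?_
    filter_upwards [isOpen_ne.mem_nhds hw] with w hw
    rw [invToOnePoint, if_neg hw]

theorem continuousAt_invOfOnePoint [ProperSpace E] {s : OnePoint E}
    (hs : s ≠ ((0 : E) : OnePoint E)) :
    ContinuousAt (invOfOnePoint : OnePoint E → E) s := by
  induction s using OnePoint.rec with
  | infty =>
    rw [OnePoint.continuousAt_infty']
    have h2 : invOfOnePoint (OnePoint.infty : OnePoint E) = 0 := rfl
    rw [h2, Filter.coclosedCompact_eq_cocompact, ← Metric.cobounded_eq_cocompact,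
      tendsto_zero_iff_norm_tendsto_zero]
    refine (tendsto_inv_atTop_zero.comp tendsto_norm_cobounded_atTop).congr fun v => ?_
    exact (norm_inv_sq_smul v).symm
  | coe v =>
    rw [OnePoint.continuousAt_coe]
    have : ‖v‖ ^ 2 ≠ 0 := by simpa using hs
    change ContinuousAt (fun v : E => (‖v‖ ^ 2)⁻¹ • v) v
    fun_prop (disch := assumption)

theorem invToOnePoint_smul_coe {v : E} (hv : v ≠ 0) {t : ℝ} (ht : t ≠ 0) :
    invToOnePoint (t • invOfOnePoint (v : OnePoint E)) = ((t⁻¹ • v : E) : OnePoint E) := by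
  have h1 : ‖v‖ ≠ 0 := by simpa using hv
  have h2 : t • invOfOnePoint (v : OnePoint E) ≠ 0 := by
    simp [invOfOnePoint, hv, ht]
  rw [invToOnePoint, if_neg h2]
  congr 1
  simp only [invOfOnePoint, OnePoint.elim_some, norm_smul, smul_smul]
  congr 1
  rw [mul_pow, Real.norm_eq_abs, sq_abs]
  field_simp

theorem invToOnePoint_smul_infty (t : ℝ) :
    invToOnePoint (t • invOfOnePoint (OnePoint.infty : OnePoint E)) = OnePoint.infty := by
  simp [invOfOnePoint, invToOnePoint]

theorem invToOnePoint_zero : invToOnePoint (0 : E) = OnePoint.infty := by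
  simp [invToOnePoint]

/-- A neighbourhood of infinity that is invariant under dilations is simply connected. -/
theorem isSimplyConnected_insert_infty [ProperSpace E] {A : Set E} (h0 : (0 : E) ∉ A)
    (hA : ∀ v ∈ A, ∀ t : ℝ, 1 ≤ t → t • v ∈ A) :
    IsSimplyConnected (insert OnePoint.infty ((fun v : E => (v : OnePoint E)) '' A)) := by
  set S : Set (OnePoint E) := insert OnePoint.infty ((fun v : E => (v : OnePoint E)) '' A) with hS
  have hmem : ∀ p : unitInterval × S,
      -- In the inverted coordinate the dilation by `(1 - t)⁻¹` is the scaling by `1 - t`, which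
      -- extends continuously to `t = 1` and contracts everything to infinity.
      invToOnePoint ((1 - (p.1 : ℝ)) • invOfOnePoint p.2.1) ∈ S := by
    rintro ⟨t, s, rfl | ⟨v, hv, rfl⟩⟩
    · rw [invToOnePoint_smul_infty]
      exact Set.mem_insert _ _
    · by_cases ht : (1 - (t : ℝ)) = 0
      · simp only [ht, zero_smul, invToOnePoint_zero]
        exact Set.mem_insert _ _
      · rw [invToOnePoint_smul_coe (fun h => h0 (h ▸ hv)) ht]
        refine Set.mem_insert_of_mem _ ⟨_, hA v hv _ ?_, rfl⟩
        exact (one_le_inv₀ (lt_of_le_of_ne (by linarith [t.2.2]) (Ne.symm ht))).2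
          (by linarith [t.2.1])
  have hcont : Continuous fun p : unitInterval × S =>
      invToOnePoint ((1 - (p.1 : ℝ)) • invOfOnePoint p.2.1) := by
    refine continuous_invToOnePoint.comp (Continuous.smul (by fun_prop) ?_)
    have h : Continuous fun s : S => invOfOnePoint s.1 := by
      rw [continuous_iff_continuousAt]
      rintro ⟨s, hs⟩
      refine ContinuousAt.comp (f := Subtype.val) (continuousAt_invOfOnePoint ?_)
        continuousAt_subtype_val
      rintro rfl
      rcases hs with hs | ⟨v, hv, hv'⟩
      · exact OnePoint.coe_ne_infty _ hs
      · exact h0 (OnePoint.coe_injective hv' ▸ hv)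
    exact h.comp continuous_snd
  refine isSimplyConnected_of_nullhomotopic ⟨⟨OnePoint.infty, Set.mem_insert _ _⟩, ⟨
    { toFun := fun p => ⟨_, hmem p⟩
      continuous_toFun := hcont.subtype_mk _
      map_zero_left := ?_
      map_one_left := ?_ }⟩⟩
  · rintro ⟨s, rfl | ⟨v, hv, rfl⟩⟩
    · refine Subtype.ext ?_
      exact invToOnePoint_smul_infty _
    · refine Subtype.ext ?_
      refine (invToOnePoint_smul_coe (fun h => h0 (h ▸ hv)) (by simp)).trans ?_
      simp
  · intro s
    refine Subtype.ext ?_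
    simp [invToOnePoint_zero]

end Inversion

namespace Piece

open RingIdx

/-- A piece, as a subset of the 3-sphere. -/
def inSphere : Piece → Set S3
  | outer => insert OnePoint.infty ((fun v : R3 => (v : S3)) '' outer.fin)
  | i => (fun v : R3 => (v : S3)) '' i.fin

/-- A piece, as a subset of the complement of the rings. -/
def set (i : Piece) : Set BorromeanComplement := Subtype.val ⁻¹' i.inSphere

theorem coe_mem_inSphere {i : Piece} {v : R3} : (v : S3) ∈ i.inSphere ↔ v ∈ i.fin := by
  cases i <;> simp [inSphere]

theorem infty_mem_inSphere {i : Piece} : (OnePoint.infty : S3) ∈ i.inSphere ↔ i = outer := by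
  cases i <;> simp [inSphere]

theorem inSphere_subset (i : Piece) : i.inSphere ⊆ borromeanRingsᶜ := by
  intro s hs
  induction s using OnePoint.rec with
  | infty =>
    rintro ⟨v, -, hv⟩
    exact OnePoint.coe_ne_infty _ hv
  | coe v => exact coe_notMem (notMem_rings_of_mem (coe_mem_inSphere.1 hs))

theorem isOpen_inSphere (i : Piece) : IsOpen i.inSphere := by
  have h : ∀ i : Piece, (fun v : R3 => (v : S3)) ⁻¹' i.inSphere = i.fin := fun i =>
    Set.ext fun v => coe_mem_inSphere
  by_cases hi : i = outer
  · rw [OnePoint.isOpen_iff_of_mem (infty_mem_inSphere.2 hi)]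
    have h1 : IsClosed ((fun v : R3 => (v : S3)) ⁻¹' i.inSphere)ᶜ := by
      rw [h i, isClosed_compl_iff]
      exact isOpen_fin i
    refine ⟨h1, Metric.isCompact_of_isClosed_isBounded h1 ?_⟩
    rw [isBounded_iff_forall_norm_le]
    refine ⟨9, fun v hv => ?_⟩
    rw [h i, hi] at hv
    simp only [fin, Set.mem_compl_iff, Set.mem_ofPred_eq, not_exists, not_lt] at hv
    have h2 : ‖v‖ ^ 2 ≤ 9 ^ 2 := by
      rw [EuclideanSpace.norm_sq_eq, Fin.sum_univ_three]
      simp only [Real.norm_eq_abs]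
      nlinarith [hv 0, hv 1, hv 2, abs_nonneg (v 0), abs_nonneg (v 1), abs_nonneg (v 2)]
    exact (sq_le_sq₀ (norm_nonneg v) (by norm_num)).1 h2
  · rw [OnePoint.isOpen_iff_of_notMem (fun h => hi (infty_mem_inSphere.1 h))]
    exact (h i) ▸ isOpen_fin i

theorem isOpen_set (i : Piece) : IsOpen i.set := (isOpen_inSphere i).preimage continuous_subtype_val

theorem exists_mem_set (x : BorromeanComplement) : ∃ i : Piece, x ∈ i.set := by
  obtain ⟨s, hs⟩ := x
  induction s using OnePoint.rec with
  | infty => exact ⟨outer, infty_mem_inSphere.2 rfl⟩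
  | coe v =>
    obtain ⟨i, hi⟩ := exists_mem_fin (v := v) fun h => hs ⟨v, h, rfl⟩
    exact ⟨i, coe_mem_inSphere.2 hi⟩

theorem convex_mid (r : RingIdx) (t : Bool) : Convex ℝ (mid r t).fin := by
  have h : ∀ i (c : ℝ), ConvexOn ℝ Set.univ fun v : R3 => |v i - c| := by
    refine fun i c => ⟨convex_univ, fun v _ w _ a b ha hb hab => ?_⟩
    have : (a • v + b • w) i - c = a * (v i - c) + b * (w i - c) := by
      simp only [PiLp.add_apply, PiLp.smul_apply, smul_eq_mul]
      linear_combination c * hab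
    dsimp only
    rw [this]
    refine (abs_add_le _ _).trans (le_of_eq ?_)
    rw [abs_mul, abs_mul, abs_of_nonneg ha, abs_of_nonneg hb]
    rfl
  have h1 := (h 1 (r.crossY t)).convex_lt (1 / 8)
  have h2 := ((h 2 0).add ((h 0 (r.crossX t)).smul (by norm_num : (0 : ℝ) ≤ 5))).convex_lt 1
  refine (congrArg (Convex ℝ) (Set.ext fun v => ?_)).mp (h1.inter h2)
  simp [fin]

theorem crossing_mem_mid (r : RingIdx) (t : Bool) :
    (!₂[r.crossX t, r.crossY t, 0] : R3) ∈ (mid r t).fin := by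
  simp [fin]

theorem isSimplyConnected_set (i : Piece) : IsSimplyConnected i.set := by
  have h1 : Subtype.val '' i.set = i.inSphere := by
    exact Set.image_preimage_eq_of_subset fun s hs => ⟨⟨s, inSphere_subset i hs⟩, rfl⟩
  rw [← IsEmbedding.subtypeVal.isSimplyConnected_image, h1]
  have h2 : ∀ {A : Set R3}, IsSimplyConnected A →
      IsSimplyConnected ((fun v : R3 => (v : S3)) '' A) := fun h =>
    OnePoint.isOpenEmbedding_coe.isEmbedding.isSimplyConnected_image.2 h
  cases i with
  | upper =>
    -- Moving up never leaves the part above the rings, and a shift by `6` carries all heights above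
    -- `-3` past the maximal height `1` of the rings.
    refine h2 (isSimplyConnected_of_translate (K := {v : R3 | 1 < v 2}) ?_ ⟨!₂[0, 0, 2], ?_⟩ ?_
      !₂[0, 0, 6] ?_ ?_)
    · exact convex_halfSpace_gt (f := fun v : R3 => v 2) ⟨fun _ _ => rfl, fun _ _ => rfl⟩ 1
    · simp
    · intro v (hv : 1 < v 2)
      exact ⟨by linarith, fun r hr => (height_bounds hr).2.trans_lt hv⟩
    · rintro v ⟨h3, h4⟩ t ht
      refine ⟨?_, fun r hr => ?_⟩
      · simp
        linarith
      · have := h4 r (by simpa [ell] using hr)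
        simp [height] at this ⊢
        linarith
    · rintro v ⟨h3, -⟩
      simp
      linarith
  | lower =>
    refine h2 (isSimplyConnected_of_translate (K := {v : R3 | v 2 < -1}) ?_ ⟨!₂[0, 0, -2], ?_⟩ ?_
      !₂[0, 0, -6] ?_ ?_)
    · exact convex_halfSpace_lt (f := fun v : R3 => v 2) ⟨fun _ _ => rfl, fun _ _ => rfl⟩ (-1)
    · simp
    · intro v (hv : v 2 < -1)
      exact ⟨by linarith, fun r hr => hv.trans_le (height_bounds hr).1⟩
    · rintro v ⟨h3, h4⟩ t ht
      refine ⟨?_, fun r hr => ?_⟩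
      · simp
        linarith
      · have := h4 r (by simpa [ell] using hr)
        simp [height] at this ⊢
        linarith
    · rintro v ⟨h3, -⟩
      simp
      linarith
  | outer =>
    refine isSimplyConnected_insert_infty ?_ ?_
    · rintro ⟨i, hi⟩
      norm_num at hi
    · rintro v ⟨i, hi⟩ t ht
      refine ⟨i, ?_⟩
      rw [PiLp.smul_apply, smul_eq_mul, abs_mul]
      nlinarith [le_abs_self t]
  | mid r t => exact h2 ((convex_mid r t).isSimplyConnected ⟨_, crossing_mem_mid r t⟩)

end Piece

/-! ### Connectedness of the overlaps -/

theorem R3.eta (v : R3) : v = !₂[v 0, v 1, v 2] := by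
  ext i
  fin_cases i <;> rfl

theorem R3.joinedIn_line {S : Set R3} {x y z x' y' z' : ℝ}
    (h : ∀ t : ℝ, 0 ≤ t → t ≤ 1 →
      (!₂[x + t * (x' - x), y + t * (y' - y), z + t * (z' - z)] : R3) ∈ S) :
    JoinedIn S !₂[x, y, z] !₂[x', y', z'] := by
  refine JoinedIn.ofLine (f := fun t : ℝ =>
    (!₂[x + t * (x' - x), y + t * (y' - y), z + t * (z' - z)] : R3)) ?_ (by simp) (by simp) ?_
  · refine Continuous.continuousOn ?_
    refine (PiLp.continuous_toLp 2 _).comp (continuous_pi fun i => ?_)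
    fin_cases i <;> simp <;> fun_prop
  · rintro _ ⟨t, ⟨h0, h1⟩, rfl⟩
    exact h t h0 h1

/-- If a set contains the box region outside an ellipse near a point on an axis, or near a point
where the ellipse is transverse to both axes, this region is connected. -/
theorem joinedIn_box_outside {p q X Y : ℝ}
    (h : ((X - p = 2 ∨ X - p = -2) ∧ Y = q) ∨
      ((X - p = 1 ∨ X - p = -1) ∧ (Y - q = 1 ∨ Y - q = -1))) {S : Set R3}
    (hS : S = {v : R3 | (|v 1 - Y| < 1 / 8 ∧ |v 2| + 5 * |v 0 - X| < 1) ∧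
      4 < (v 0 - p) ^ 2 + 3 * (v 1 - q) ^ 2}) {v w : R3} (hv : v ∈ S) (hw : w ∈ S) :
    JoinedIn S v w := by
  -- an outer vertical line of the box
  obtain ⟨σ, hσ, hσX⟩ : ∃ σ : ℝ, (σ = 1 ∨ σ = -1) ∧ 1 ≤ σ * (X - p) := by
    rcases h with ⟨h | h, -⟩ | ⟨h | h, -⟩
    · exact ⟨1, Or.inl rfl, by linarith⟩
    · exact ⟨-1, Or.inr rfl, by linarith⟩
    · exact ⟨1, Or.inl rfl, by linarith⟩
    · exact ⟨-1, Or.inr rfl, by linarith⟩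
  have hσ2 : σ * σ = 1 := by rcases hσ with h | h <;> rw [h] <;> norm_num
  have hbox : ∀ v ∈ S, |v 0 - X| < 1 / 5 := by
    intro v hv
    rw [hS] at hv
    have := abs_nonneg (v 2)
    linarith [hv.1.2]
  -- The line at distance `m` is at least as far out as both points, so that both are pushed away
  -- from the centre of the ellipse, and it still meets the box. The lower bound `1 / 10` keeps it
  -- strictly beyond a vertex of the ellipse.
  obtain ⟨m, hm, hm0, hvm, hwm⟩ : ∃ m : ℝ, m < 1 / 5 ∧ 0 < m ∧ |v 0 - X| ≤ m ∧ |w 0 - X| ≤ m :=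
    ⟨max (1 / 10) (max |v 0 - X| |w 0 - X|), by
      simp only [max_lt_iff]
      exact ⟨by norm_num, hbox v hv, hbox w hw⟩, by positivity,
      (le_max_left _ _).trans (le_max_right _ _), (le_max_right _ _).trans (le_max_right _ _)⟩
  have key : ∀ v ∈ S, |v 0 - X| ≤ m → JoinedIn S v !₂[X + σ * m, v 1, 0] := by
    intro v hv hvm
    have hv' := hv
    rw [hS] at hv'
    obtain ⟨⟨h1, h2⟩, h3⟩ := hv'
    conv => enter [2]; rw [R3.eta v]
    refine R3.joinedIn_line fun t h0 h1' => ?_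
    rw [hS]
    have hσv : σ * (v 0 - X) ≤ m := by
      refine (le_abs_self _).trans ?_
      rw [abs_mul]
      rcases hσ with h | h <;> simpa [h] using hvm
    have hσv' : -m ≤ σ * (v 0 - X) := by
      refine le_trans (neg_le_neg ?_) (neg_abs_le _)
      rw [abs_mul]
      rcases hσ with h | h <;> simpa [h] using hvm
    refine ⟨⟨?_, ?_⟩, ?_⟩
    · simpa using h1
    · have e1 : |v 2 + t * (0 - v 2)| = (1 - t) * |v 2| := by
        have : v 2 + t * (0 - v 2) = (1 - t) * v 2 := by ring
        rw [this, abs_mul, abs_of_nonneg (by linarith : 0 ≤ 1 - t)]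
      have e2 : |v 0 + t * (X + σ * m - v 0) - X| ≤ (1 - t) * |v 0 - X| + t * m := by
        have : v 0 + t * (X + σ * m - v 0) - X = (1 - t) * (v 0 - X) + t * (σ * m) := by ring
        rw [this]
        refine (abs_add_le _ _).trans (le_of_eq ?_)
        rw [abs_mul, abs_mul, abs_of_nonneg h0, abs_of_nonneg (by linarith : 0 ≤ 1 - t), abs_mul,
          abs_of_pos hm0]
        rcases hσ with h | h <;> simp [h]
      change |v 2 + t * (0 - v 2)| + 5 * |v 0 + t * (X + σ * m - v 0) - X| < 1
      rw [e1]
      rcases h0.eq_or_lt with rfl | h0'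
      · linarith
      · nlinarith
    · change 4 < (v 0 + t * (X + σ * m - v 0) - p) ^ 2 + 3 * (v 1 + t * (v 1 - v 1) - q) ^ 2
      have e3 : σ * (v 0 - p) ≤ σ * (v 0 + t * (X + σ * m - v 0) - p) := by
        have : σ * (v 0 + t * (X + σ * m - v 0) - p) =
            σ * (v 0 - p) + t * (σ * σ * m - σ * (v 0 - X)) := by ring
        rw [this, hσ2]
        nlinarith
      have e4 : 0 ≤ σ * (v 0 - p) := by
        have : σ * (v 0 - p) = σ * (X - p) + σ * (v 0 - X) := by ring
        linarith
      have e5 := pow_le_pow_left₀ e4 e3 2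
      rw [mul_pow, mul_pow, sq σ, hσ2] at e5
      rw [sub_self, mul_zero, add_zero]
      linarith
  have slice : JoinedIn S !₂[X + σ * m, v 1, 0] !₂[X + σ * m, w 1, 0] := by
    have hv1 := (key v hv hvm).target_mem
    have hw1 := (key w hw hwm).target_mem
    rw [hS] at hv1 hw1
    obtain ⟨⟨h1, h2⟩, h3⟩ := hv1
    obtain ⟨⟨h1', -⟩, h3'⟩ := hw1
    change |v 1 - Y| < 1 / 8 at h1
    change |w 1 - Y| < 1 / 8 at h1'
    change |(0 : ℝ)| + 5 * |X + σ * m - X| < 1 at h2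
    change 4 < (X + σ * m - p) ^ 2 + 3 * (v 1 - q) ^ 2 at h3
    change 4 < (X + σ * m - p) ^ 2 + 3 * (w 1 - q) ^ 2 at h3'
    refine R3.joinedIn_line fun t h0 h1'' => ?_
    rw [hS]
    rw [abs_lt] at h1 h1'
    refine ⟨⟨?_, ?_⟩, ?_⟩
    · change |v 1 + t * (w 1 - v 1) - Y| < 1 / 8
      rw [abs_lt]
      rcases le_total (v 1) (w 1) with hle | hle <;>
        have e1 := mul_nonneg h0 (sub_nonneg.2 hle) <;>
        have e2 := mul_nonneg (sub_nonneg.2 h1'') (sub_nonneg.2 hle) <;>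
        constructor <;> linarith
    · simpa using h2
    · change 4 < (X + σ * m + t * (X + σ * m - (X + σ * m)) - p) ^ 2 +
        3 * (v 1 + t * (w 1 - v 1) - q) ^ 2
      rw [sub_self, mul_zero, add_zero]
      -- At a vertex the whole line is outside the ellipse. At a transverse point `y - q` keeps its
      -- sign in the box, so along the segment its square is at least that at one of the ends.
      rcases h with ⟨h, -⟩ | ⟨-, h⟩
      · have e1 : 2 < σ * (X + σ * m - p) := by
          have : σ * (X + σ * m - p) = σ * (X - p) + σ * σ * m := by ring
          rw [this, hσ2]
          rcases h with h | h <;> rw [h] at hσX ⊢ <;> rcases hσ with h' | h' <;>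
            rw [h'] at hσX ⊢ <;> linarith
        have e2 := pow_lt_pow_left₀ e1 (by norm_num) two_ne_zero
        rw [mul_pow, sq σ, hσ2] at e2
        nlinarith [sq_nonneg (v 1 + t * (w 1 - v 1) - q)]
      · have e1 : (v 1 - q) ^ 2 ≤ (v 1 + t * (w 1 - v 1) - q) ^ 2 ∨
            (w 1 - q) ^ 2 ≤ (v 1 + t * (w 1 - v 1) - q) ^ 2 := by
          rcases le_total (v 1) (w 1) with hle | hle <;> rcases h with h | h
          · left; nlinarith [mul_nonneg h0 (sub_nonneg.2 hle)]
          · right; nlinarith [mul_nonneg (sub_nonneg.2 h1'') (sub_nonneg.2 hle)]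
          · right; nlinarith [mul_nonneg (sub_nonneg.2 h1'') (sub_nonneg.2 hle)]
          · left; nlinarith [mul_nonneg h0 (sub_nonneg.2 hle)]
        rcases e1 with e1 | e1 <;> linarith
  exact ((key v hv hvm).trans slice).trans (key w hw hwm).symm

namespace Piece

open RingIdx

/-- The overlap can be pushed up into a half-space. The bound `-3 < v 2` in `upper` matters here:
without it, the points far below the inner faces would form further components. -/
theorem joinedIn_upper_outer {v w : R3} (hv : v ∈ upper.fin ∩ outer.fin)
    (hw : w ∈ upper.fin ∩ outer.fin) : JoinedIn (upper.fin ∩ outer.fin) v w := by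
  refine IsSimplyConnected.isPathConnected (isSimplyConnected_of_translate
    (K := {v : R3 | 5 < v 2}) ?_ ⟨!₂[0, 0, 6], ?_⟩ ?_ !₂[0, 0, 10] ?_ ?_) |>.joinedIn v hv w hw
  · exact convex_halfSpace_gt (f := fun v : R3 => v 2) ⟨fun _ _ => rfl, fun _ _ => rfl⟩ 5
  · change (5 : ℝ) < 6
    norm_num
  · intro v (hv : 5 < v 2)
    exact ⟨⟨by linarith, fun r hr => (height_bounds hr).2.trans_lt (by linarith)⟩, 2,
      hv.trans_le (le_abs_self _)⟩
  · rintro v ⟨⟨h3, h4⟩, i, hi⟩ t ht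
    refine ⟨⟨?_, fun r hr => ?_⟩, i, ?_⟩
    · simp
      linarith
    · have := h4 r (by simpa [ell] using hr)
      simp [height] at this ⊢
      linarith
    · fin_cases i
      · simpa using hi
      · simpa using hi
      · simp at hi ⊢
        rw [lt_abs] at hi ⊢
        rcases hi with hi | hi
        · left; linarith
        · linarith
  · rintro v ⟨⟨h3, -⟩, -⟩
    simp
    linarith

theorem joinedIn_lower_outer {v w : R3} (hv : v ∈ lower.fin ∩ outer.fin)
    (hw : w ∈ lower.fin ∩ outer.fin) : JoinedIn (lower.fin ∩ outer.fin) v w := by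
  refine IsSimplyConnected.isPathConnected (isSimplyConnected_of_translate
    (K := {v : R3 | v 2 < -5}) ?_ ⟨!₂[0, 0, -6], ?_⟩ ?_ !₂[0, 0, -10] ?_ ?_) |>.joinedIn v hv w hw
  · exact convex_halfSpace_lt (f := fun v : R3 => v 2) ⟨fun _ _ => rfl, fun _ _ => rfl⟩ (-5)
  · change (-6 : ℝ) < -5
    norm_num
  · intro v (hv : v 2 < -5)
    exact ⟨⟨by linarith, fun r hr => lt_of_lt_of_le (by linarith) (height_bounds hr).1⟩, 2,
      lt_abs.2 (Or.inr (by linarith))⟩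
  · rintro v ⟨⟨h3, h4⟩, i, hi⟩ t ht
    refine ⟨⟨?_, fun r hr => ?_⟩, i, ?_⟩
    · simp
      linarith
    · have := h4 r (by simpa [ell] using hr)
      simp [height] at this ⊢
      linarith
    · fin_cases i
      · simpa using hi
      · simpa using hi
      · simp at hi ⊢
        rw [lt_abs] at hi ⊢
        rcases hi with hi | hi
        · linarith
        · right; linarith
  · rintro v ⟨⟨h3, -⟩, -⟩
    simp
    linarith

theorem convex_inside (r : RingIdx) : Convex ℝ {v : R3 | r.ell v < 4} := by
  intro v (hv : (v 0 - r.cx) ^ 2 + 3 * (v 1 - r.cy) ^ 2 < 4) w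
    (hw : (w 0 - r.cx) ^ 2 + 3 * (w 1 - r.cy) ^ 2 < 4) a b ha hb hab
  change ((a • v + b • w) 0 - r.cx) ^ 2 + 3 * ((a • v + b • w) 1 - r.cy) ^ 2 < 4
  obtain rfl : b = 1 - a := by linarith
  simp only [PiLp.add_apply, PiLp.smul_apply, smul_eq_mul]
  have h1 := mul_nonneg (mul_nonneg ha hb) (sq_nonneg (v 0 - w 0))
  have h2 := mul_nonneg (mul_nonneg ha hb) (sq_nonneg (v 1 - w 1))
  rcases ha.eq_or_lt with rfl | ha'
  · nlinarith
  · nlinarith [mul_lt_mul_of_pos_left hv ha', mul_le_mul_of_nonneg_left hw.le hb]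

theorem joinedIn_mid_inside {r s : RingIdx} {t : Bool} {v w : R3}
    (hv : v ∈ (mid r t).fin) (hv' : s.ell v < 4) (hw : w ∈ (mid r t).fin) (hw' : s.ell w < 4) :
    JoinedIn ((mid r t).fin ∩ {v | s.ell v < 4}) v w :=
  (((convex_mid r t).inter (convex_inside s)).isPathConnected ⟨v, hv, hv'⟩).joinedIn
    v ⟨hv, hv'⟩ w ⟨hw, hw'⟩

theorem joinedIn_mid_outside {r s : RingIdx} {t : Bool} (hs : s = r ∨ s = r.under) {v w : R3}
    (hv : v ∈ (mid r t).fin) (hv' : 4 < s.ell v) (hw : w ∈ (mid r t).fin) (hw' : 4 < s.ell w) :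
    JoinedIn ((mid r t).fin ∩ {v | 4 < s.ell v}) v w := by
  refine joinedIn_box_outside (p := s.cx) (q := s.cy) (X := r.crossX t) (Y := r.crossY t) ?_ rfl
    ⟨hv, hv'⟩ ⟨hw, hw'⟩
  rcases hs with rfl | rfl
  · cases s <;> cases t <;> norm_num [crossX, crossY, cx, cy]
  · cases r <;> cases t <;> norm_num [crossX, crossY, cx, cy, RingIdx.under]

end Piece

/-! ### The faces of the diagram -/

/-- The part of a convex cone between the unit levels of two homogeneous functions is
path-connected. -/
theorem joinedIn_cone {E : Type*} [AddCommGroup E] [Module ℝ E] [TopologicalSpace E]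
    [IsTopologicalAddGroup E] [ContinuousSMul ℝ E] {C : Set E} (hC : Convex ℝ C)
    (hcone : ∀ w ∈ C, ∀ t : ℝ, 0 < t → t • w ∈ C) {lo hi : E → ℝ} (hlo : Continuous lo)
    (hhi : Continuous hi) (hlo' : ∀ w, ∀ t : ℝ, 0 < t → lo (t • w) = t * lo w)
    (hhi' : ∀ w, ∀ t : ℝ, 0 < t → hi (t • w) = t * hi w) (h0 : ∀ w, 0 ≤ lo w)
    (hlt : ∀ w ∈ C, lo w < hi w) {v w : E} (hv : v ∈ C ∧ lo v < 1 ∧ 1 < hi v)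
    (hw : w ∈ C ∧ lo w < 1 ∧ 1 < hi w) :
    JoinedIn {w | w ∈ C ∧ lo w < 1 ∧ 1 < hi w} v w := by
  let f : E × ℝ → E := fun p => ((1 - p.2) * lo p.1 + p.2 * hi p.1)⁻¹ • p.1
  have hpos : ∀ p ∈ C ×ˢ Set.Ioo (0 : ℝ) 1, 0 < (1 - p.2) * lo p.1 + p.2 * hi p.1 := by
    rintro ⟨w, s⟩ ⟨hw, hs0, hs1⟩
    have h1 := h0 w
    have h2 := hlt w hw
    dsimp only at *
    have h3 : 0 ≤ (1 - s) * lo w := mul_nonneg (by linarith) h1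
    have h4 : 0 < s * hi w := mul_pos hs0 (by linarith)
    linarith
  have himg : f '' (C ×ˢ Set.Ioo (0 : ℝ) 1) = {w | w ∈ C ∧ lo w < 1 ∧ 1 < hi w} := by
    ext w
    constructor
    · rintro ⟨⟨w, s⟩, hp, rfl⟩
      have h1 := hpos _ hp
      obtain ⟨hw, hs0, hs1⟩ := hp
      have h2 := hlt w hw
      dsimp only [f] at *
      refine ⟨hcone w hw _ (inv_pos.2 h1), ?_, ?_⟩
      · rw [hlo' _ _ (inv_pos.2 h1), inv_mul_lt_iff₀ h1]
        nlinarith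
      · rw [hhi' _ _ (inv_pos.2 h1), lt_inv_mul_iff₀ h1]
        nlinarith
    · rintro ⟨hw, h1, h2⟩
      have h3 : 0 < hi w - lo w := by linarith
      refine ⟨(w, (1 - lo w) / (hi w - lo w)), ⟨hw, div_pos (by linarith) h3, ?_⟩, ?_⟩
      · rw [div_lt_one h3]
        linarith
      · have : (1 - (1 - lo w) / (hi w - lo w)) * lo w + (1 - lo w) / (hi w - lo w) * hi w = 1 := by
          field_simp
          ring
        simp only [f, this, inv_one, one_smul]
  rw [← himg]
  have hpc : IsPathConnected (f '' (C ×ˢ Set.Ioo (0 : ℝ) 1)) := by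
    have hne : (C ×ˢ Set.Ioo (0 : ℝ) 1).Nonempty := ⟨(v, 1 / 2), hv.1, by norm_num⟩
    refine ((hC.prod (convex_Ioo 0 1)).isPathConnected hne).image' ?_
    refine ContinuousOn.smul (ContinuousOn.inv₀ ?_ fun p hp => (hpos p hp).ne')
      continuous_fst.continuousOn
    fun_prop
  exact hpc.joinedIn v (himg.symm ▸ hv) w (himg.symm ▸ hw)

theorem sqrt_sq_add_sub_lt {b b' k : ℝ} (hk : 0 < k) (h : b' < b) :
    √(b ^ 2 + k) - b < √(b' ^ 2 + k) - b' := by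
  have h1 : b' < √(b' ^ 2 + k) := (le_abs_self b').trans_lt (Real.lt_sqrt (abs_nonneg _) |>.2 (by
    rw [sq_abs]; linarith))
  have h2 : √(b ^ 2 + k) < √(b' ^ 2 + k) + (b - b') := by
    have h3 : √(b' ^ 2 + k) ^ 2 = b' ^ 2 + k := Real.sq_sqrt (by positivity)
    rw [Real.sqrt_lt' (by linarith [Real.sqrt_nonneg (b' ^ 2 + k)])]
    nlinarith [mul_pos (sub_pos.2 h) (sub_pos.2 h1)]
  linarith

namespace RingIdx

/-- The linear part of the quadratic form at the centre `(0, 1 / 3)` of the diagram. -/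
def lin : RingIdx → ℝ × ℝ → ℝ
  | top, w => 2 * w.2
  | left, w => -w.1 - w.2
  | right, w => w.1 - w.2

/-- The quadratic part of the forms. -/
def quad (w : ℝ × ℝ) : ℝ := w.1 ^ 2 + 3 * w.2 ^ 2

/-- The point of the plane `z = 0` at a given position from the centre of the diagram. -/
noncomputable def planePt (w : ℝ × ℝ) : R3 := !₂[w.1, 1 / 3 + w.2, 0]

theorem ell_planePt (r : RingIdx) (w : ℝ × ℝ) :
    r.ell (planePt w) = 4 / 3 + quad w - 2 * r.lin w := by
  cases r <;> simp [ell, planePt, quad, lin, cx, cy] <;> ring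

theorem continuous_planePt : Continuous planePt := by
  refine (PiLp.continuous_toLp 2 _).comp (continuous_pi fun i => ?_)
  fin_cases i <;> simp <;> fun_prop

/-- The gauge of the ellipse with respect to the centre of the diagram. -/
noncomputable def gau (r : RingIdx) (w : ℝ × ℝ) : ℝ :=
  3 / 8 * (√(r.lin w ^ 2 + 8 / 3 * quad w) - r.lin w)

theorem continuous_lin (r : RingIdx) : Continuous r.lin := by
  cases r <;> unfold lin <;> fun_prop

theorem continuous_gau (r : RingIdx) : Continuous r.gau := by
  have := r.continuous_lin
  unfold gau quad
  fun_prop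

theorem lin_smul (r : RingIdx) (w : ℝ × ℝ) (t : ℝ) : r.lin (t • w) = t * r.lin w := by
  cases r <;> simp [lin] <;> ring

theorem lin_add (r : RingIdx) (w w' : ℝ × ℝ) : r.lin (w + w') = r.lin w + r.lin w' := by
  cases r <;> simp [lin] <;> ring

theorem gau_smul (r : RingIdx) (w : ℝ × ℝ) (t : ℝ) (ht : 0 < t) : r.gau (t • w) = t * r.gau w := by
  have h : (t * r.lin w) ^ 2 + 8 / 3 * quad (t • w) = t ^ 2 * (r.lin w ^ 2 + 8 / 3 * quad w) := by
    simp [quad]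
    ring
  rw [gau, gau, lin_smul, h, Real.sqrt_mul (sq_nonneg t), Real.sqrt_sq ht.le]
  ring

theorem quad_nonneg (w : ℝ × ℝ) : 0 ≤ quad w := by unfold quad; positivity

theorem gau_nonneg (r : RingIdx) (w : ℝ × ℝ) : 0 ≤ r.gau w := by
  have : r.lin w ≤ √(r.lin w ^ 2 + 8 / 3 * quad w) :=
    Real.le_sqrt_of_sq_le (by linarith [quad_nonneg w])
  unfold gau
  linarith

theorem gau_lt_one_iff (r : RingIdx) (w : ℝ × ℝ) : r.gau w < 1 ↔ r.ell (planePt w) < 4 := by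
  have hq := quad_nonneg w
  rw [ell_planePt]
  have : r.gau w < 1 ↔ √(r.lin w ^ 2 + 8 / 3 * quad w) < 8 / 3 + r.lin w := by
    unfold gau
    constructor <;> intro h <;> linarith
  rw [this]
  constructor
  · intro h
    have h1 : 0 < 8 / 3 + r.lin w := (Real.sqrt_nonneg _).trans_lt h
    rw [Real.sqrt_lt' h1] at h
    linarith
  · intro h
    rw [Real.sqrt_lt' (by linarith)]
    linarith

theorem one_lt_gau_iff (r : RingIdx) (w : ℝ × ℝ) : 1 < r.gau w ↔ 4 < r.ell (planePt w) := by
  have hq := quad_nonneg w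
  rw [ell_planePt]
  have : 1 < r.gau w ↔ 8 / 3 + r.lin w < √(r.lin w ^ 2 + 8 / 3 * quad w) := by
    unfold gau
    constructor <;> intro h <;> linarith
  rw [this]
  rcases le_or_gt 0 (8 / 3 + r.lin w) with h1 | h1
  · rw [Real.lt_sqrt h1]
    constructor <;> intro h <;> linarith
  · exact ⟨fun _ => by linarith, fun _ => h1.trans_le (Real.sqrt_nonneg _)⟩

theorem gau_lt_gau {r s : RingIdx} {w : ℝ × ℝ} (h : s.lin w < r.lin w) : r.gau w < s.gau w := by
  have hq : 0 < quad w := by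
    rcases (quad_nonneg w).eq_or_lt with h' | h'
    · exfalso
      unfold quad at h'
      have h1 : w.1 = 0 := by nlinarith [sq_nonneg w.1, sq_nonneg w.2]
      have h2 : w.2 = 0 := by nlinarith [sq_nonneg w.1, sq_nonneg w.2]
      cases r <;> cases s <;> simp [lin, h1, h2] at h
    · exact h'
  have := sqrt_sq_add_sub_lt (k := 8 / 3 * quad w) (by linarith) h
  unfold gau
  linarith

theorem joinedIn_face {i₁ i₂ j₁ j₂ : RingIdx} {S : Set (ℝ × ℝ)}
    (hS : S = {w | (i₁.ell (planePt w) < 4 ∧ i₂.ell (planePt w) < 4) ∧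
      4 < j₁.ell (planePt w) ∧ 4 < j₂.ell (planePt w)}) {v w : ℝ × ℝ} (hv : v ∈ S) (hw : w ∈ S) :
    JoinedIn S v w := by
  let C : Set (ℝ × ℝ) := {w | (j₁.lin w < i₁.lin w ∧ j₁.lin w < i₂.lin w) ∧
    j₂.lin w < i₁.lin w ∧ j₂.lin w < i₂.lin w}
  have hCS : {w | w ∈ C ∧ max (i₁.gau w) (i₂.gau w) < 1 ∧ 1 < min (j₁.gau w) (j₂.gau w)} = S := by
    ext w
    simp only [hS, C, Set.mem_ofPred_eq, max_lt_iff, lt_min_iff, gau_lt_one_iff, one_lt_gau_iff]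
    refine ⟨fun h => h.2, fun h => ⟨?_, h⟩⟩
    simp only [ell_planePt] at h
    refine ⟨⟨?_, ?_⟩, ?_, ?_⟩ <;> linarith
  rw [← hCS] at hv hw ⊢
  refine joinedIn_cone (C := C) (lo := fun w => max (i₁.gau w) (i₂.gau w))
    (hi := fun w => min (j₁.gau w) (j₂.gau w)) ?_ ?_ (i₁.continuous_gau.max i₂.continuous_gau)
    (j₁.continuous_gau.min j₂.continuous_gau) ?_ ?_ ?_ ?_ hv hw
  · intro v hv w hw a b ha hb hab
    have key : ∀ {i j : RingIdx}, j.lin v < i.lin v → j.lin w < i.lin w →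
        j.lin (a • v + b • w) < i.lin (a • v + b • w) := by
      intro i j h1 h2
      simp only [lin_add, lin_smul]
      rcases ha.eq_or_lt with rfl | ha'
      · have : b = 1 := by linarith
        subst this
        linarith
      · linarith [mul_lt_mul_of_pos_left h1 ha', mul_le_mul_of_nonneg_left h2.le hb]
    exact ⟨⟨key hv.1.1 hw.1.1, key hv.1.2 hw.1.2⟩, key hv.2.1 hw.2.1, key hv.2.2 hw.2.2⟩
  · intro w hw t ht
    simp only [C, Set.mem_ofPred_eq, lin_smul, mul_lt_mul_iff_right₀ ht]
    exact hw
  · intro w t ht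
    simp only [gau_smul _ _ _ ht, mul_max_of_nonneg _ _ ht.le]
  · intro w t ht
    simp only [gau_smul _ _ _ ht, mul_min_of_nonneg _ _ ht.le]
  · exact fun w => le_max_of_le_left (i₁.gau_nonneg w)
  · rintro w ⟨⟨h1, h2⟩, h3, h4⟩
    simp only [max_lt_iff, lt_min_iff]
    exact ⟨⟨gau_lt_gau h1, gau_lt_gau h2⟩, gau_lt_gau h3, gau_lt_gau h4⟩

/-- The rings whose ellipses contain the point in their interior. -/
noncomputable def inside (v : R3) (r : RingIdx) : Bool := decide (r.ell v < 4)

theorem inside_eq_true {v : R3} {r : RingIdx} : inside v r = true ↔ r.ell v < 4 := by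
  simp [inside]

theorem inside_eq_false {v : R3} {r : RingIdx} : inside v r = false ↔ 4 ≤ r.ell v := by
  simp [inside]

end RingIdx

namespace Piece

open RingIdx

theorem mem_upper_lower_iff {v : R3} :
    v ∈ upper.fin ∩ lower.fin ↔ (-3 < v 2 ∧ v 2 < 3) ∧ ∀ r : RingIdx, r.ell v ≠ 4 :=
  ⟨fun h => ⟨⟨h.1.1, h.2.1⟩, ell_ne_of_upper_lower h.1 h.2⟩,
    fun h => ⟨mem_upper_of_ne h.1.1 h.2, mem_lower_of_ne h.1.2 h.2⟩⟩

theorem ell_congr {v w : R3} (h0 : v 0 = w 0) (h1 : v 1 = w 1) (r : RingIdx) :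
    r.ell v = r.ell w := by
  rw [ell, ell, h0, h1]

theorem joinedIn_planePt {v : R3} (hv : v ∈ upper.fin ∩ lower.fin) :
    JoinedIn (upper.fin ∩ lower.fin) v (planePt (v 0, v 1 - 1 / 3)) := by
  rw [mem_upper_lower_iff] at hv
  conv => enter [2]; rw [R3.eta v]
  have : planePt (v 0, v 1 - 1 / 3) = !₂[v 0, v 1, 0] := by simp [planePt]
  rw [this]
  refine R3.joinedIn_line fun t h0 h1 => mem_upper_lower_iff.2 ⟨⟨?_, ?_⟩, fun r => ?_⟩
  · simp
    nlinarith
  · simp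
    nlinarith
  · rw [ell_congr (w := v) (by simp) (by simp)]
    exact hv.2 r

theorem planePt_mem {w : ℝ × ℝ} (h : ∀ r : RingIdx, r.ell (planePt w) ≠ 4) :
    planePt w ∈ upper.fin ∩ lower.fin :=
  mem_upper_lower_iff.2 ⟨by simp [planePt], h⟩

theorem joinedIn_upper_lower {v w : R3} (hv : v ∈ upper.fin ∩ lower.fin)
    (hw : w ∈ upper.fin ∩ lower.fin) (h : inside v = inside w) (hne : ∃ r, inside v r = true) :
    JoinedIn (upper.fin ∩ lower.fin) v w := by
  suffices H : JoinedIn (upper.fin ∩ lower.fin) (planePt (v 0, v 1 - 1 / 3))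
      (planePt (w 0, w 1 - 1 / 3)) from
    ((joinedIn_planePt hv).trans H).trans (joinedIn_planePt hw).symm
  have hin : ∀ {v : R3}, v ∈ upper.fin ∩ lower.fin → ∀ r : RingIdx,
      (inside v r = true → r.ell (planePt (v 0, v 1 - 1 / 3)) < 4) ∧
      (inside v r = false → 4 < r.ell (planePt (v 0, v 1 - 1 / 3))) := by
    intro v hv r
    rw [ell_congr (w := v) (by simp [planePt]) (by simp [planePt]), inside_eq_true, inside_eq_false]
    exact ⟨id, fun h => lt_of_le_of_ne h ((mem_upper_lower_iff.1 hv).2 r).symm⟩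
  have face : ∀ i₁ i₂ j₁ j₂ : RingIdx, (inside v i₁ = true ∧ inside v i₂ = true) →
      (inside v j₁ = false ∧ inside v j₂ = false) →
      (∀ r, (r = i₁ ∨ r = i₂) ∨ (r = j₁ ∨ r = j₂)) →
      JoinedIn (upper.fin ∩ lower.fin) (planePt (v 0, v 1 - 1 / 3))
        (planePt (w 0, w 1 - 1 / 3)) := by
    intro i₁ i₂ j₁ j₂ hi hj hall
    have hj1 := joinedIn_face (i₁ := i₁) (i₂ := i₂) (j₁ := j₁) (j₂ := j₂) rfl
      (v := (v 0, v 1 - 1 / 3)) (w := (w 0, w 1 - 1 / 3))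
      ⟨⟨(hin hv _).1 hi.1, (hin hv _).1 hi.2⟩, (hin hv _).2 hj.1, (hin hv _).2 hj.2⟩
      (by
        rw [h] at hi hj
        exact ⟨⟨(hin hw _).1 hi.1, (hin hw _).1 hi.2⟩, (hin hw _).2 hj.1, (hin hw _).2 hj.2⟩)
    refine (hj1.map continuous_planePt).mono ?_
    rintro _ ⟨u, ⟨⟨h1, h2⟩, h3, h4⟩, rfl⟩
    refine planePt_mem fun r => ?_
    rcases hall r with (rfl | rfl) | (rfl | rfl)
    exacts [h1.ne, h2.ne, h3.ne', h4.ne']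
  cases ht : inside v .top <;> cases hl : inside v .left <;> cases hr : inside v .right
  · obtain ⟨r, hr'⟩ := hne
    cases r <;> simp_all
  · exact face .right .right .top .left (by simp_all) (by simp_all) (by rintro (_ | _ | _) <;> simp)
  · exact face .left .left .top .right (by simp_all) (by simp_all) (by rintro (_ | _ | _) <;> simp)
  · exact face .left .right .top .top (by simp_all) (by simp_all) (by rintro (_ | _ | _) <;> simp)
  · exact face .top .top .left .right (by simp_all) (by simp_all) (by rintro (_ | _ | _) <;> simp)
  · exact face .top .right .left .left (by simp_all) (by simp_all) (by rintro (_ | _ | _) <;> simp)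
  · exact face .top .left .right .right (by simp_all) (by simp_all)
      (by rintro (_ | _ | _) <;> simp)
  · have hall : ∀ r, inside v r = true := by rintro (_ | _ | _) <;> assumption
    refine JoinedIn.of_segment_subset fun u hu => ?_
    have h3 : ∀ r : RingIdx, r.ell u < 4 := fun r => by
      refine (convex_inside r).segment_subset ?_ ?_ hu
      · exact (hin hv r).1 (hall r)
      · exact (hin hw r).1 (h ▸ hall r)
    have h4 : u 2 = 0 := by
      obtain ⟨a, b, -, -, -, rfl⟩ := hu
      simp [planePt]
    exact mem_upper_lower_iff.2 ⟨by rw [h4]; norm_num, fun r => (h3 r).ne⟩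

theorem exists_joinedIn_outer {v : R3} (hv : v ∈ upper.fin ∩ lower.fin)
    (h : ∀ r, inside v r = false) :
    ∃ w ∈ outer.fin, JoinedIn (upper.fin ∩ lower.fin) v w := by
  have hE : ∀ r : RingIdx, 4 < r.ell (planePt (v 0, v 1 - 1 / 3)) := by
    intro r
    rw [ell_congr (w := v) (by simp [planePt]) (by simp [planePt])]
    exact lt_of_le_of_ne (inside_eq_false.1 (h r)) ((mem_upper_lower_iff.1 hv).2 r).symm
  have hj := joinedIn_planePt hv
  generalize (v 0, v 1 - 1 / 3) = w at hE hj
  simp only [ell_planePt] at hE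
  have hq : 8 / 3 < quad w := by
    have h1 := hE .top
    have h2 := hE .left
    have h3 := hE .right
    simp only [lin] at h1 h2 h3
    linarith
  refine ⟨planePt ((20 : ℝ) • w), ?_, hj.trans ?_⟩
  · by_contra hcon
    simp only [fin, Set.mem_ofPred_eq, not_exists, not_lt] at hcon
    have h0 := hcon 0
    have h1 := hcon 1
    simp [planePt] at h0 h1
    rw [abs_le] at h1
    have h0' : |w.1| ≤ 1 / 4 := by linarith
    rw [abs_le] at h0'
    unfold quad at hq
    nlinarith
  · refine JoinedIn.ofLine (f := fun t : ℝ => planePt ((1 + 19 * t) • w)) ?_ (by simp)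
      (by norm_num) ?_
    · refine Continuous.continuousOn (continuous_planePt.comp ?_)
      fun_prop
    · rintro _ ⟨t, ⟨h0, h1⟩, rfl⟩
      refine planePt_mem fun r => ne_of_gt ?_
      have hr := hE r
      rw [ell_planePt, lin_smul]
      have : quad ((1 + 19 * t) • w) = (1 + 19 * t) ^ 2 * quad w := by
        simp [quad]
        ring
      rw [this]
      nlinarith [mul_nonneg h0 (quad_nonneg w), mul_nonneg (mul_nonneg h0 h0) (quad_nonneg w),
        mul_nonneg h0 (sub_nonneg.2 hr.le)]

end Piece

/-! ### Colourings of the faces -/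

/-- The face of the diagram given by its position with respect to the three ellipses. -/
def tri (t l r : Bool) : RingIdx → Bool
  | .top => t
  | .left => l
  | .right => r

namespace RingIdx

/-- The face of the diagram given by its position with respect to a ring, the ring below it, and
the third ring. -/
def pat : RingIdx → Bool → Bool → Bool → RingIdx → Bool
  | top, o, u, t => tri o t u
  | left, o, u, t => tri u o t
  | right, o, u, t => tri t u o

theorem eq_pat (r : RingIdx) (f : RingIdx → Bool) : f = pat r (f r) (f r.under) (f r.third) := by
  cases r <;> funext s <;> cases s <;> rfl

theorem pat_self (r : RingIdx) (o u t : Bool) : pat r o u t r = o := by cases r <;> rfl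

theorem pat_under (r : RingIdx) (o u t : Bool) : pat r o u t r.under = u := by cases r <;> rfl

end RingIdx

open RingIdx

/-- The relations of the Dehn presentation: the outer face is trivial, and at each crossing the
quotient of the colours on the two sides of the upper strand is the same on both sides of the lower
strand. -/
structure IsDehn {G : Type*} [Group G] (x : (RingIdx → Bool) → G) : Prop where
  outer : x (tri false false false) = 1
  crossing : ∀ (r : RingIdx) (t : Bool),
    x (pat r true false t) * (x (pat r false false t))⁻¹ =
      x (pat r true true t) * (x (pat r false true t))⁻¹

namespace Arc

/-- The face in which the arrow of an arc starts. -/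
def startFace : Arc → RingIdx → Bool
  | a => tri false false false
  | b => tri false false false
  | c => tri false false false
  | d => tri false true false
  | e => tri false false true
  | f => tri true false false

/-- The face in which the arrow of an arc ends. -/
def finishFace : Arc → RingIdx → Bool
  | a => tri true false false
  | b => tri false true false
  | c => tri false false true
  | d => tri true true false
  | e => tri false true true
  | f => tri true false true

theorem inside_start (g : Arc) : inside g.start = g.startFace := by
  funext r
  cases g <;> cases r <;> norm_num [inside, ell, start, startFace, tri, cx, cy]

theorem inside_finish (g : Arc) : inside g.finish = g.finishFace := by
  funext r
  cases g <;> cases r <;> norm_num [inside, ell, finish, finishFace, tri, cx, cy]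

end Arc

namespace IsDehn

variable {G : Type*} [Group G] {x : (RingIdx → Bool) → G}

/-- The element of a group with a Dehn colouring that belongs to an arc. -/
def ofArc (x : (RingIdx → Bool) → G) (g : Arc) : G := x g.finishFace * (x g.startFace)⁻¹

theorem eq_ofArc (hx : IsDehn x) :
    (x (tri true false false) = ofArc x .a ∧ x (tri false true false) = ofArc x .b ∧
      x (tri false false true) = ofArc x .c) ∧
    (x (tri true true false) = ofArc x .d * ofArc x .b ∧
      x (tri false true true) = ofArc x .e * ofArc x .c ∧
      x (tri true false true) = ofArc x .f * ofArc x .a) := by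
  simp [ofArc, Arc.finishFace, Arc.startFace, hx.outer]

theorem relations (hx : IsDehn x) :
    (ofArc x .d * ofArc x .b = ofArc x .b * ofArc x .a ∧
      ofArc x .e * ofArc x .c = ofArc x .c * ofArc x .b ∧
      ofArc x .f * ofArc x .a = ofArc x .a * ofArc x .c) ∧
    (x (tri true true true) = ofArc x .f * ofArc x .d * ofArc x .b ∧
      x (tri true true true) = ofArc x .e * ofArc x .f * ofArc x .a ∧
      x (tri true true true) = ofArc x .d * ofArc x .e * ofArc x .c) := by
  obtain ⟨⟨ha, hb, hc⟩, hd, he, hf⟩ := hx.eq_ofArc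
  have h1 := hx.crossing .left false
  have h2 := hx.crossing .right false
  have h3 := hx.crossing .top false
  have h4 := hx.crossing .right true
  have h5 := hx.crossing .left true
  have h6 := hx.crossing .top true
  simp only [pat, hx.outer, ha, hb, hc, hd, he, hf, inv_one, mul_one, mul_inv_cancel_right] at *
  refine ⟨⟨mul_inv_eq_iff_eq_mul.1 h1.symm, mul_inv_eq_iff_eq_mul.1 h2.symm,
    mul_inv_eq_iff_eq_mul.1 h3.symm⟩, ?_, ?_, ?_⟩
  · rw [mul_assoc]; exact mul_inv_eq_iff_eq_mul.1 h4.symm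
  · rw [mul_assoc]; exact mul_inv_eq_iff_eq_mul.1 h5.symm
  · rw [mul_assoc]; exact mul_inv_eq_iff_eq_mul.1 h6.symm

theorem lift_eq_one (hx : IsDehn x) {w : FreeGroup Arc} (hw : w ∈ Wirtinger.rels) :
    FreeGroup.lift (ofArc x) w = 1 := by
  obtain ⟨⟨h1, h2, h3⟩, h4, h5, h6⟩ := hx.relations
  generalize x (tri true true true) = z at *
  rcases hw with rfl | rfl | rfl | rfl | rfl | rfl <;>
    simp only [Wirtinger.R₁, Wirtinger.R₂, Wirtinger.R₃, Wirtinger.R₄, Wirtinger.R₅, Wirtinger.R₆,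
      map_mul, map_inv, FreeGroup.lift_apply_of] <;>
    generalize ofArc x .a = a at * <;> generalize ofArc x .b = b at * <;>
    generalize ofArc x .c = c at * <;> generalize ofArc x .d = d at * <;>
    generalize ofArc x .e = e at * <;> generalize ofArc x .f = f at *
  · rw [mul_assoc d⁻¹, ← h1]; group
  · have : f * d = d * c := by
      have : f * d * b = d * c * b := by rw [← h4, h6, mul_assoc d, h2, mul_assoc]
      exact mul_right_cancel this
    rw [this]; group
  · have : e * f = f * b := by
      have : e * f * a = f * b * a := by rw [← h5, h4, mul_assoc f, h1, mul_assoc]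
      exact mul_right_cancel this
    rw [this]; group
  · rw [h3]; group
  · rw [h2]; group
  · have : d * e = e * a := by
      have : d * e * c = e * a * c := by rw [← h6, h5, mul_assoc e, h3, mul_assoc]
      exact mul_right_cancel this
    rw [this]; group

theorem mem_of_forall_ofArc (hx : IsDehn x) {H : Subgroup G} (hH : ∀ g, ofArc x g ∈ H)
    (φ : RingIdx → Bool) : x φ ∈ H := by
  obtain ⟨⟨ha, hb, hc⟩, hd, he, hf⟩ := hx.eq_ofArc
  have h4 := hx.relations.2.1
  have hφ : φ = tri (φ .top) (φ .left) (φ .right) := by funext s; cases s <;> rfl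
  rw [hφ]
  cases φ .top <;> cases φ .left <;> cases φ .right
  · rw [hx.outer]; exact H.one_mem
  · rw [hc]; exact hH _
  · rw [hb]; exact hH _
  · rw [he]; exact H.mul_mem (hH _) (hH _)
  · rw [ha]; exact hH _
  · rw [hf]; exact H.mul_mem (hH _) (hH _)
  · rw [hd]; exact H.mul_mem (hH _) (hH _)
  · rw [h4]; exact H.mul_mem (H.mul_mem (hH _) (hH _)) (hH _)

end IsDehn

namespace Wirtinger

/-- The Wirtinger group. -/
abbrev Grp : Type := PresentedGroup rels

/-- The image of an arc in the Wirtinger group. -/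
abbrev arc (g : Arc) : Grp := PresentedGroup.of g

/-- The Dehn colouring by the Wirtinger group. -/
def color (φ : RingIdx → Bool) : Grp :=
  match φ .top, φ .left, φ .right with
  | false, false, false => 1
  | true, false, false => arc .a
  | false, true, false => arc .b
  | false, false, true => arc .c
  | true, true, false => arc .d * arc .b
  | false, true, true => arc .e * arc .c
  | true, false, true => arc .f * arc .a
  | true, true, true => arc .f * arc .d * arc .b

theorem mk_eq_one {w : FreeGroup Arc} (hw : w ∈ rels) : PresentedGroup.mk rels w = 1 :=
  (PresentedGroup.mk_eq_one_iff).2 (Subgroup.subset_normalClosure hw)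

theorem arc_relations :
    (arc .d * arc .b = arc .b * arc .a ∧ arc .f * arc .d = arc .d * arc .c ∧
      arc .e * arc .f = arc .f * arc .b) ∧
    (arc .f * arc .a = arc .a * arc .c ∧ arc .e * arc .c = arc .c * arc .b ∧
      arc .d * arc .e = arc .e * arc .a) := by
  have h1 : (arc .d)⁻¹ * arc .b * arc .a * (arc .b)⁻¹ = 1 := mk_eq_one (w := R₁) (by simp [rels])
  have h2 : arc .f * arc .d * (arc .c)⁻¹ * (arc .d)⁻¹ = 1 := mk_eq_one (w := R₂) (by simp [rels])
  have h3 : arc .e * arc .f * (arc .b)⁻¹ * (arc .f)⁻¹ = 1 := mk_eq_one (w := R₃) (by simp [rels])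
  have h4 : arc .f * arc .a * (arc .c)⁻¹ * (arc .a)⁻¹ = 1 := mk_eq_one (w := R₄) (by simp [rels])
  have h5 : arc .e * arc .c * (arc .b)⁻¹ * (arc .c)⁻¹ = 1 := mk_eq_one (w := R₅) (by simp [rels])
  have h6 : arc .d * arc .e * (arc .a)⁻¹ * (arc .e)⁻¹ = 1 := mk_eq_one (w := R₆) (by simp [rels])
  refine ⟨⟨?_, ?_, ?_⟩, ?_, ?_, ?_⟩
  · rw [mul_inv_eq_one, mul_assoc, inv_mul_eq_iff_eq_mul] at h1
    exact h1.symm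
  · rwa [mul_inv_eq_one, mul_inv_eq_iff_eq_mul] at h2
  · rwa [mul_inv_eq_one, mul_inv_eq_iff_eq_mul] at h3
  · rwa [mul_inv_eq_one, mul_inv_eq_iff_eq_mul] at h4
  · rwa [mul_inv_eq_one, mul_inv_eq_iff_eq_mul] at h5
  · rwa [mul_inv_eq_one, mul_inv_eq_iff_eq_mul] at h6

theorem isDehn_color : IsDehn color := by
  obtain ⟨⟨h1, h2, h3⟩, h4, h5, h6⟩ := arc_relations
  refine ⟨rfl, fun r t => ?_⟩
  have e2 : arc .f * arc .d * arc .b = arc .d * arc .e * arc .c := by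
    rw [h2, mul_assoc, mul_assoc, h5]
  have e3 : arc .f * arc .d * arc .b = arc .e * arc .f * arc .a := by
    rw [h3, mul_assoc, mul_assoc, h1]
  cases r <;> cases t <;> simp only [pat, tri, color]
  · rw [h4]; group
  · rw [e2]; group
  · rw [h1]; group
  · rw [e3]; group
  · rw [h5]; group
  · group

theorem ofArc_color (g : Arc) : IsDehn.ofArc color g = arc g := by
  cases g <;> simp [IsDehn.ofArc, color, Arc.finishFace, Arc.startFace, tri]

end Wirtinger

/-! ### The homomorphism defined by a colouring -/

namespace Piece

open RingIdx

theorem mid_disjoint {r r' : RingIdx} {t t' : Bool} {v : R3} (h : v ∈ (mid r t).fin)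
    (h' : v ∈ (mid r' t').fin) : mid r t = mid r' t' := by
  obtain ⟨⟨h1, h2⟩, -⟩ := mid_bounds h
  obtain ⟨⟨h3, h4⟩, -⟩ := mid_bounds h'
  rw [abs_lt] at h1 h2 h3 h4
  have h5 : |r.crossX t - r'.crossX t'| < 1 := abs_lt.2 ⟨by linarith, by linarith⟩
  have h6 : |r.crossY t - r'.crossY t'| < 1 := abs_lt.2 ⟨by linarith, by linarith⟩
  clear h h' h1 h2 h3 h4
  cases r <;> cases t <;> cases r' <;> cases t' <;> first
    | rfl
    | (exfalso; norm_num [crossX] at h5; done)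
    | (exfalso; norm_num [crossY] at h6)

theorem mid_outer_disjoint {r : RingIdx} {t : Bool} {v : R3} (h : v ∈ (mid r t).fin)
    (h' : v ∈ outer.fin) : False := by
  obtain ⟨⟨h1, h2⟩, h3⟩ := mid_bounds h
  obtain ⟨i, hi⟩ := h'
  have h4 : |r.crossX t| ≤ 2 := by cases r <;> cases t <;> norm_num [crossX]
  have h5 : |r.crossY t| ≤ 2 := by cases r <;> cases t <;> norm_num [crossY]
  have h6 := abs_sub_abs_le_abs_sub (v 0) (r.crossX t)
  have h7 := abs_sub_abs_le_abs_sub (v 1) (r.crossY t)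
  fin_cases i <;> simp at hi <;> linarith

theorem eventually_inside {v : R3} {r : RingIdx} (h : r.ell v ≠ 4) :
    ∀ᶠ w in 𝓝 v, inside w r = inside v r := by
  rcases lt_or_gt_of_ne h with h | h
  · filter_upwards [r.continuous_ell.continuousAt.eventually_lt continuousAt_const h] with w hw
    rw [inside_eq_true.2 h, inside_eq_true.2 hw]
  · filter_upwards [continuousAt_const.eventually_lt r.continuous_ell.continuousAt h] with w hw
    rw [inside_eq_false.2 h.le, inside_eq_false.2 hw.le]

theorem inside_third {r : RingIdx} {t : Bool} {v : R3} (h : v ∈ (mid r t).fin) :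
    inside v r.third = t := by
  cases t
  · exact inside_eq_false.2 (mid_third_false h).le
  · exact inside_eq_true.2 (mid_third_true h)

theorem inside_eq_pat {r : RingIdx} {t : Bool} {v : R3} (h : v ∈ (mid r t).fin) :
    inside v = pat r (inside v r) (inside v r.under) t := by
  conv_lhs => rw [eq_pat r (inside v), inside_third h]

variable {G : Type*} [Group G] (x : (RingIdx → Bool) → G)

/-- The local sections of the covering space that belongs to a colouring. -/
noncomputable def sec : Piece → R3 → G
  | upper, _ => 1
  | outer, _ => 1
  | lower, v => if -3 < v 2 then x (inside v) else 1
  | mid r t, v => if inside v r then x (pat r true false t) * (x (pat r false false t))⁻¹ else 1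

variable {x}

theorem sec_lower {v : R3} (h : v ∈ upper.fin) : sec x lower v = x (inside v) := if_pos h.1

theorem sec_lower_outer (hx : IsDehn x) {v : R3} (h : v ∈ lower.fin) (h' : v ∈ outer.fin) :
    sec x lower v = 1 := by
  simp only [sec]
  split_ifs with h3
  · obtain ⟨i, hi⟩ := h'
    have h4 : 5 < |v 0| ∨ 5 < |v 1| := by
      fin_cases i
      · exact Or.inl hi
      · exact Or.inr hi
      · have := h.1
        have : 5 < |v 2| := hi
        rw [lt_abs] at this
        rcases this with h | h <;> linarith
    have : inside v = tri false false false := by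
      funext r
      rw [inside_eq_false.2 (ell_gt_of_far h4 r).le]
      cases r <;> rfl
    rw [this, hx.outer]
  · rfl

theorem sec_lower_mid (hx : IsDehn x) {r : RingIdx} {t : Bool} {v : R3} (h : v ∈ (mid r t).fin) :
    (sec x lower v)⁻¹ * sec x (mid r t) v = (x (pat r false (inside v r.under) t))⁻¹ := by
  have h3 : -3 < v 2 := by linarith [(abs_lt.1 (mid_bounds h).2).1]
  simp only [sec, if_pos h3]
  rw [inside_eq_pat h, pat_self, pat_under]
  have h4 := hx.crossing r t
  cases inside v r
  · simp
  · cases inside v r.under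
    · simp
    · simp [h4]

/-- The quotient of two local sections is locally constant. -/
theorem sec_locally_constant (hx : IsDehn x) (i j : Piece) {v : R3} (hi : v ∈ i.fin)
    (hj : v ∈ j.fin) :
    ∀ᶠ w in 𝓝 v, (sec x i w)⁻¹ * sec x j w = (sec x i v)⁻¹ * sec x j v := by
  have hsymm : ∀ {i j : Piece}, (∀ᶠ w in 𝓝 v, (sec x i w)⁻¹ * sec x j w =
      (sec x i v)⁻¹ * sec x j v) → ∀ᶠ w in 𝓝 v, (sec x j w)⁻¹ * sec x i w =
      (sec x j v)⁻¹ * sec x i v := by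
    intro i j h
    filter_upwards [h] with w hw
    rw [← inv_inj]
    simpa using hw
  have hnhds : ∀ {i : Piece}, v ∈ i.fin → ∀ᶠ w in 𝓝 v, w ∈ i.fin := fun {i} h =>
    (isOpen_fin i).mem_nhds h
  have hUW : v ∈ upper.fin → v ∈ lower.fin → ∀ᶠ w in 𝓝 v, (sec x upper w)⁻¹ * sec x lower w =
      (sec x upper v)⁻¹ * sec x lower v := by
    intro h1 h2
    filter_upwards [hnhds h1, Filter.eventually_all.2
      fun r => eventually_inside (ell_ne_of_upper_lower h1 h2 r)] with w hw hw'
    rw [sec_lower h1, sec_lower hw, funext hw']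
    rfl
  have hWV : v ∈ lower.fin → v ∈ outer.fin → ∀ᶠ w in 𝓝 v, (sec x lower w)⁻¹ * sec x outer w =
      (sec x lower v)⁻¹ * sec x outer v := by
    intro h1 h2
    filter_upwards [hnhds h1, hnhds h2] with w hw hw'
    rw [sec_lower_outer hx h1 h2, sec_lower_outer hx hw hw']
    rfl
  have hUN : ∀ r t, v ∈ upper.fin → v ∈ (mid r t).fin →
      ∀ᶠ w in 𝓝 v, (sec x upper w)⁻¹ * sec x (mid r t) w =
        (sec x upper v)⁻¹ * sec x (mid r t) v := by
    intro r t h1 h2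
    filter_upwards [eventually_inside (ell_ne_of_upper_mid h1 h2)] with w hw
    simp only [sec, hw]
  have hWN : ∀ r t, v ∈ lower.fin → v ∈ (mid r t).fin →
      ∀ᶠ w in 𝓝 v, (sec x lower w)⁻¹ * sec x (mid r t) w =
        (sec x lower v)⁻¹ * sec x (mid r t) v := by
    intro r t h1 h2
    filter_upwards [hnhds h2, eventually_inside (ell_ne_of_lower_mid h1 h2)] with w hw hw'
    rw [sec_lower_mid hx h2, sec_lower_mid hx hw, hw']
  have hself : ∀ i : Piece, ∀ᶠ w in 𝓝 v, (sec x i w)⁻¹ * sec x i w =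
      (sec x i v)⁻¹ * sec x i v := fun i => Filter.Eventually.of_forall fun w => by simp
  have hUV : ∀ᶠ w in 𝓝 v, (sec x upper w)⁻¹ * sec x outer w =
      (sec x upper v)⁻¹ * sec x outer v := Filter.Eventually.of_forall fun w => rfl
  cases i with
  | upper =>
    cases j with
    | upper => exact hself _
    | lower => exact hUW hi hj
    | outer => exact hUV
    | mid r t => exact hUN r t hi hj
  | lower =>
    cases j with
    | upper => exact hsymm (hUW hj hi)
    | lower => exact hself _
    | outer => exact hWV hi hj
    | mid r t => exact hWN r t hi hj
  | outer =>
    cases j with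
    | upper => exact hsymm hUV
    | lower => exact hsymm (hWV hj hi)
    | outer => exact hself _
    | mid r t => exact (mid_outer_disjoint hj hi).elim
  | mid r t =>
    cases j with
    | upper => exact hsymm (hUN r t hj hi)
    | lower => exact hsymm (hWN r t hj hi)
    | outer => exact (mid_outer_disjoint hi hj).elim
    | mid r' t' => exact mid_disjoint hi hj ▸ hself _

end Piece

open Piece RingIdx

theorem ray_mem_upper (x y : ℝ)
    (h : ∀ t : ℝ, 3 / 4 ≤ t → t ≤ 1 →
      (t * x) ^ 2 + 3 * (t * y - 1) ^ 2 ≠ 4 ∧ (t * x + 1) ^ 2 + 3 * (t * y) ^ 2 ≠ 4 ∧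
        (t * x - 1) ^ 2 + 3 * (t * y) ^ 2 ≠ 4) (t : unitInterval) :
    AffineMap.lineMap basePoint (!₂[x, y, -2] : R3) (t : ℝ) ∈ upper.fin := by
  obtain ⟨t, h0, h1⟩ := t
  have hz : (AffineMap.lineMap basePoint (!₂[x, y, -2] : R3) t) 2 = 10 - 12 * t := by
    simp [basePoint, AffineMap.lineMap_apply]
    ring
  refine ⟨by rw [hz]; linarith, fun r hr => ?_⟩
  rw [hz]
  by_contra! hcon
  have h3 := (height_bounds hr).2
  obtain ⟨e1, e2, e3⟩ := h t (by linarith) h1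
  cases r
  · exact e1 (by simpa [basePoint, AffineMap.lineMap_apply, ell, cx, cy] using hr)
  · exact e2 (by simpa [basePoint, AffineMap.lineMap_apply, ell, cx, cy] using hr)
  · exact e3 (by simpa [basePoint, AffineMap.lineMap_apply, ell, cx, cy] using hr)

theorem Arc.segment_start_mem (g : Arc) (t : unitInterval) :
    AffineMap.lineMap basePoint g.start (t : ℝ) ∈ upper.fin := by
  cases g <;> refine ray_mem_upper _ _ (fun t h1 h2 => ⟨?_, ?_, ?_⟩) t <;> intro h3 <;> nlinarith

theorem Arc.segment_finish_mem (g : Arc) (t : unitInterval) :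
    AffineMap.lineMap basePoint g.finish (t : ℝ) ∈ upper.fin := by
  cases g <;> refine ray_mem_upper _ _ (fun t h1 h2 => ⟨?_, ?_, ?_⟩) t <;> intro h3 <;> nlinarith

theorem Arc.segment_start_finish_mem (g : Arc) (t : unitInterval) :
    AffineMap.lineMap g.start g.finish (t : ℝ) ∈ lower.fin := by
  have hz : (AffineMap.lineMap g.start g.finish (t : ℝ)) 2 = -2 := by
    cases g <;> simp [Arc.start, Arc.finish, AffineMap.lineMap_apply]
  exact ⟨by rw [hz]; norm_num, fun r hr => by rw [hz]; linarith [(height_bounds hr).1]⟩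

theorem Arc.start_mem_upper (g : Arc) : g.start ∈ upper.fin := by
  simpa using g.segment_start_mem 1

theorem Arc.finish_mem_upper (g : Arc) : g.finish ∈ upper.fin := by
  simpa using g.segment_finish_mem 1

theorem Arc.start_mem_lower (g : Arc) : g.start ∈ lower.fin := by
  simpa using g.segment_start_finish_mem 0

theorem Arc.finish_mem_lower (g : Arc) : g.finish ∈ lower.fin := by
  simpa using g.segment_start_finish_mem 1

namespace Arc

/-- The first side of the meridian loop. -/
noncomputable def startPath (g : Arc) : Path base (toComplement g.start g.start_notMem) :=
  segmentPath basePoint g.start basePoint_notMem g.start_notMem g.segment_start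

/-- The second side of the meridian loop. -/
noncomputable def underPath (g : Arc) :
    Path (toComplement g.start g.start_notMem) (toComplement g.finish g.finish_notMem) :=
  segmentPath g.start g.finish g.start_notMem g.finish_notMem g.segment_start_finish

/-- The third side of the meridian loop, reversed. -/
noncomputable def finishPath (g : Arc) : Path base (toComplement g.finish g.finish_notMem) :=
  segmentPath basePoint g.finish basePoint_notMem g.finish_notMem g.segment_finish

theorem loop_eq (g : Arc) : g.loop = g.startPath.trans (g.underPath.trans g.finishPath.symm) := rfl

theorem startPath_mem (g : Arc) (t : unitInterval) : g.startPath t ∈ upper.set :=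
  coe_mem_inSphere.2 (g.segment_start_mem t)

theorem underPath_mem (g : Arc) (t : unitInterval) : g.underPath t ∈ lower.set :=
  coe_mem_inSphere.2 (g.segment_start_finish_mem t)

theorem finishPath_mem (g : Arc) (t : unitInterval) : g.finishPath t ∈ upper.set :=
  coe_mem_inSphere.2 (g.segment_finish_mem t)

end Arc

/-- A colouring of the faces defines a homomorphism from the fundamental group. -/
theorem exists_hom_of_isDehn {G : Type*} [Group G] {x : (RingIdx → Bool) → G} (hx : IsDehn x) :
    ∃ ψ : FundamentalGroup BorromeanComplement base →* G,
      ∀ g : Arc, ψ g.meridian = IsDehn.ofArc x g := by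
  let s : Piece → BorromeanComplement → G := fun i p => p.1.elim 1 (sec x i)
  obtain ⟨T, hT, hT'⟩ := exists_transport (fun i : Piece => i.set) isOpen_set exists_mem_set s (by
    rintro i j ⟨p, hp⟩ ⟨hi, hj⟩
    induction p using OnePoint.rec with
    | infty =>
      have hi' := infty_mem_inSphere.1 hi
      have hj' := infty_mem_inSphere.1 hj
      subst hi' hj'
      exact Filter.Eventually.of_forall fun w => by simp
    | coe v =>
      have h := sec_locally_constant hx i j (coe_mem_inSphere.1 hi) (coe_mem_inSphere.1 hj)
      have h' : ∀ᶠ q : S3 in 𝓝 (v : S3), (q.elim 1 (sec x i))⁻¹ * q.elim 1 (sec x j) =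
          (sec x i v)⁻¹ * sec x j v := by
        rw [OnePoint.nhds_coe_eq, Filter.eventually_map]
        exact h
      exact (continuous_subtype_val.tendsto (⟨v, hp⟩ : BorromeanComplement)).eventually h')
  refine ⟨MonoidHom.mk' (fun p => T base base p) fun p q => hT _ _ _ q p, fun g => ?_⟩
  change T base base (.mk g.loop) = _
  rw [Arc.loop_eq, Path.Homotopic.Quotient.mk_trans, hT, Path.Homotopic.Quotient.mk_trans, hT,
    hT' upper _ _ _ g.startPath_mem, hT' lower _ _ _ g.underPath_mem,
    hT' upper _ _ g.finishPath.symm fun t => g.finishPath_mem _]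
  change 1 * 1⁻¹ * (sec x lower g.finish * (sec x lower g.start)⁻¹) * (1 * 1⁻¹) = _
  rw [sec_lower g.start_mem_upper, sec_lower g.finish_mem_upper, g.inside_start, g.inside_finish]
  simp [IsDehn.ofArc]

/-! ### The colouring by the fundamental group -/

open Piece RingIdx

namespace RingIdx

/-- A point near a crossing, outside the two rings of the crossing. -/
noncomputable def cornerOut : RingIdx → Bool → ℝ × ℝ
  | top, true => (-1 / 10, 0)
  | top, false => (1 / 10, 0)
  | left, true => (1 / 10, 0)
  | left, false => (-1 / 10, 0)
  | right, true => (0, 1 / 10)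
  | right, false => (0, -1 / 10)

/-- A point near a crossing, outside the upper ring and inside the lower ring. -/
noncomputable def cornerMixed : RingIdx → Bool → ℝ × ℝ
  | top, _ => (1 / 10, -1 / 10)
  | left, _ => (1 / 10, 1 / 10)
  | right, _ => (-1 / 10, 0)

/-- The position from the crossing of a point in each of the four faces there. -/
noncomputable def cornerPos (r : RingIdx) (t : Bool) : Bool → Bool → ℝ × ℝ
  | false, false => r.cornerOut t
  | true, true => -r.cornerOut t
  | false, true => r.cornerMixed t
  | true, false => -r.cornerMixed t

/-- A point in each of the four faces at a crossing. -/
noncomputable def corner (r : RingIdx) (t o u : Bool) : R3 :=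
  !₂[r.crossX t + (r.cornerPos t o u).1, r.crossY t + (r.cornerPos t o u).2, 0]

theorem corner_mem_mid (r : RingIdx) (t o u : Bool) : r.corner t o u ∈ (mid r t).fin := by
  constructor
  · change |r.crossY t + (r.cornerPos t o u).2 - r.crossY t| < 1 / 8
    rw [add_sub_cancel_left, abs_lt]
    cases r <;> cases t <;> cases o <;> cases u <;>
      norm_num [cornerPos, cornerOut, cornerMixed]
  · change |(0 : ℝ)| + 5 * |r.crossX t + (r.cornerPos t o u).1 - r.crossX t| < 1
    rw [add_sub_cancel_left, abs_zero, zero_add]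
    have : |(r.cornerPos t o u).1| < 1 / 5 := by
      rw [abs_lt]
      cases r <;> cases t <;> cases o <;> cases u <;>
        norm_num [cornerPos, cornerOut, cornerMixed]
    linarith

theorem ell_corner (r : RingIdx) (t u : Bool) :
    (4 < r.ell (r.corner t false u) ∧ r.ell (r.corner t true u) < 4) ∧
      4 < r.under.ell (r.corner t u false) ∧ r.under.ell (r.corner t u true) < 4 := by
  cases r <;> cases t <;> cases u <;>
    norm_num [ell, corner, cornerPos, cornerOut, cornerMixed, cx, cy, crossX, crossY,
      RingIdx.under]

theorem inside_corner_self (r : RingIdx) (t o u : Bool) : inside (r.corner t o u) r = o := by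
  cases o
  · exact inside_eq_false.2 (ell_corner r t u).1.1.le
  · exact inside_eq_true.2 (ell_corner r t u).1.2

theorem inside_corner_under (r : RingIdx) (t o u : Bool) :
    inside (r.corner t o u) r.under = u := by
  cases u
  · exact inside_eq_false.2 (ell_corner r t o).2.1.le
  · exact inside_eq_true.2 (ell_corner r t o).2.2

theorem inside_corner (r : RingIdx) (t o u : Bool) : inside (r.corner t o u) = pat r o u t := by
  rw [inside_eq_pat (corner_mem_mid r t o u), inside_corner_self, inside_corner_under]

theorem corner_mem_upper (r : RingIdx) (t o u : Bool) : r.corner t o u ∈ upper.fin := by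
  refine mem_upper_of_mid (corner_mem_mid r t o u) ?_
  cases o
  · exact (ell_corner r t u).1.1.ne'
  · exact (ell_corner r t u).1.2.ne

theorem corner_mem_lower (r : RingIdx) (t o u : Bool) : r.corner t o u ∈ lower.fin := by
  refine mem_lower_of_mid (corner_mem_mid r t o u) ?_
  cases u
  · exact (ell_corner r t o).2.1.ne'
  · exact (ell_corner r t o).2.2.ne

end RingIdx

namespace Piece

/-- Points on the same side of the upper ring. -/
theorem joinedIn_upper_mid {r : RingIdx} {t : Bool} {v w : R3} (hv : v ∈ upper.fin ∩ (mid r t).fin)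
    (hw : w ∈ upper.fin ∩ (mid r t).fin) (h : inside v r = inside w r) :
    JoinedIn (upper.fin ∩ (mid r t).fin) v w := by
  have hv' := ell_ne_of_upper_mid hv.1 hv.2
  have hw' := ell_ne_of_upper_mid hw.1 hw.2
  cases hvr : inside v r with
  | false =>
    rw [hvr] at h
    refine (joinedIn_mid_outside (Or.inl rfl) hv.2
      (lt_of_le_of_ne (inside_eq_false.1 hvr) hv'.symm) hw.2
      (lt_of_le_of_ne (inside_eq_false.1 h.symm) hw'.symm)).mono ?_
    rintro u ⟨h1, h2⟩
    exact ⟨mem_upper_of_mid h1 (ne_of_gt h2), h1⟩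
  | true =>
    rw [hvr] at h
    refine (joinedIn_mid_inside hv.2 (inside_eq_true.1 hvr) hw.2 (inside_eq_true.1 h.symm)).mono ?_
    rintro u ⟨h1, h2⟩
    exact ⟨mem_upper_of_mid h1 (ne_of_lt h2), h1⟩

/-- Points on the same side of the lower ring. -/
theorem joinedIn_lower_mid {r : RingIdx} {t : Bool} {v w : R3} (hv : v ∈ lower.fin ∩ (mid r t).fin)
    (hw : w ∈ lower.fin ∩ (mid r t).fin) (h : inside v r.under = inside w r.under) :
    JoinedIn (lower.fin ∩ (mid r t).fin) v w := by
  have hv' := ell_ne_of_lower_mid hv.1 hv.2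
  have hw' := ell_ne_of_lower_mid hw.1 hw.2
  cases hvr : inside v r.under with
  | false =>
    rw [hvr] at h
    refine (joinedIn_mid_outside (Or.inr rfl) hv.2
      (lt_of_le_of_ne (inside_eq_false.1 hvr) hv'.symm) hw.2
      (lt_of_le_of_ne (inside_eq_false.1 h.symm) hw'.symm)).mono ?_
    rintro u ⟨h1, h2⟩
    exact ⟨mem_lower_of_mid h1 (ne_of_gt h2), h1⟩
  | true =>
    rw [hvr] at h
    refine (joinedIn_mid_inside hv.2 (inside_eq_true.1 hvr) hw.2 (inside_eq_true.1 h.symm)).mono ?_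
    rintro u ⟨h1, h2⟩
    exact ⟨mem_lower_of_mid h1 (ne_of_lt h2), h1⟩

theorem basePoint_mem_upper : basePoint ∈ upper.fin := by
  simpa using Arc.segment_start_mem .a 0

theorem basePoint_mem_outer : basePoint ∈ outer.fin :=
  ⟨2, by change (5 : ℝ) < |10|; norm_num⟩

/-- A point far below the diagram. -/
noncomputable def nadir : R3 := !₂[0, 0, -10]

theorem nadir_mem_lower : nadir ∈ lower.fin := by
  have h : nadir 2 = -10 := rfl
  exact ⟨by rw [h]; norm_num, fun r hr => by rw [h]; linarith [(height_bounds hr).1]⟩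

theorem nadir_mem_outer : nadir ∈ outer.fin :=
  ⟨2, by change (5 : ℝ) < |-10|; norm_num⟩

/-- A point of a piece, as a point of the complement. -/
def pt {i : Piece} (v : R3) (h : v ∈ i.fin) : BorromeanComplement :=
  toComplement v (notMem_rings_of_mem h)

theorem joinedIn_pt {i j k l : Piece} {v w : R3} (hv : v ∈ k.fin) (hw : w ∈ l.fin)
    (h : JoinedIn (i.fin ∩ j.fin) v w) : JoinedIn (i.set ∩ j.set) (pt v hv) (pt w hw) := by
  obtain ⟨p, hp⟩ := h
  refine ⟨⟨⟨fun t => pt (p t) (hp t).1, ?_⟩, ?_, ?_⟩, fun t => ?_⟩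
  · exact (OnePoint.continuous_coe.comp p.continuous).subtype_mk _
  · simp [pt]
  · simp [pt]
  · exact ⟨coe_mem_inSphere.2 (hp t).1, coe_mem_inSphere.2 (hp t).2⟩

end Piece

/-- A frame is normalized if it is trivial above the rings and outside a large box, is extended
from there to the part below the rings, and agrees at each crossing with the part above the
rings. -/
def Frame.Normalized (Γ : Frame base (fun i : Piece => i.set)) : Prop :=
    Γ.toPath upper base (coe_mem_inSphere.2 basePoint_mem_upper) = .refl base ∧
    Γ.toPath outer base (coe_mem_inSphere.2 basePoint_mem_outer) = .refl base ∧
    Γ.toPath lower (pt nadir nadir_mem_lower) (coe_mem_inSphere.2 nadir_mem_lower) =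
      Γ.toPath outer (pt nadir nadir_mem_lower) (coe_mem_inSphere.2 nadir_mem_outer) ∧
    ∀ r t, Γ.toPath (mid r t) (pt _ (corner_mem_mid r t false false))
        (coe_mem_inSphere.2 (corner_mem_mid r t false false)) =
      Γ.toPath upper (pt _ (corner_mem_mid r t false false))
        (coe_mem_inSphere.2 (corner_mem_upper r t false false))

theorem exists_normalized_frame :
    ∃ Γ : Frame base (fun i : Piece => i.set), Γ.Normalized := by
  obtain ⟨ΓU, hU, hU'⟩ := (isSimplyConnected_set upper).exists_frame
    (x₀ := base) (coe_mem_inSphere.2 basePoint_mem_upper) (.refl base)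
  obtain ⟨ΓV, hV, hV'⟩ := (isSimplyConnected_set outer).exists_frame
    (x₀ := base) (coe_mem_inSphere.2 basePoint_mem_outer) (.refl base)
  obtain ⟨ΓW, hW, hW'⟩ := (isSimplyConnected_set lower).exists_frame
    (x₀ := pt nadir nadir_mem_lower) (coe_mem_inSphere.2 nadir_mem_lower)
    (ΓV (pt nadir nadir_mem_lower) (coe_mem_inSphere.2 nadir_mem_outer))
  choose ΓN hN hN' using fun r t => (isSimplyConnected_set (mid r t)).exists_frame
    (x₀ := pt _ (corner_mem_mid r t false false))
    (coe_mem_inSphere.2 (corner_mem_mid r t false false))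
    (ΓU (pt _ (corner_mem_mid r t false false))
      (coe_mem_inSphere.2 (corner_mem_upper r t false false)))
  refine ⟨⟨fun i => match i with
    | .upper => ΓU
    | .outer => ΓV
    | .lower => ΓW
    | .mid r t => ΓN r t, fun i => ?_⟩, hU, hV, hW, hN⟩
  cases i with
  | upper => exact hU'
  | outer => exact hV'
  | lower => exact hW'
  | mid r t => exact hN' r t

theorem exists_fin_of_ne {i j : Piece} (h : i ≠ j) {p : BorromeanComplement} (hi : p ∈ i.set)
    (hj : p ∈ j.set) : ∃ (v : R3) (hv : v ∈ i.fin), v ∈ j.fin ∧ p = pt v hv := by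
  obtain ⟨p, hp⟩ := p
  induction p using OnePoint.rec with
  | infty => exact absurd ((infty_mem_inSphere.1 hi).trans (infty_mem_inSphere.1 hj).symm) h
  | coe v => exact ⟨v, coe_mem_inSphere.1 hi, coe_mem_inSphere.1 hj, rfl⟩

theorem quotient_trans_symm_trans_trans {X : Type*} [TopologicalSpace X] {x y z w w' : X}
    (p : Path.Homotopic.Quotient x y) (q : Path.Homotopic.Quotient w y)
    (r : Path.Homotopic.Quotient y z) (s : Path.Homotopic.Quotient z w') :
    (p.trans q.symm).trans ((q.trans r).trans s) = p.trans (r.trans s) := by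
  simp only [Path.Homotopic.Quotient.trans_assoc]
  rw [← Path.Homotopic.Quotient.trans_assoc q.symm, Path.Homotopic.Quotient.symm_trans,
    Path.Homotopic.Quotient.refl_trans]

section Color

variable (Γ : Frame base (fun i : Piece => i.set))

/-- The transition element of a frame at a point of space. -/
noncomputable def Frame.gAt (i j : Piece) (v : R3) (hi : v ∈ i.fin) (hj : v ∈ j.fin) :
    FundamentalGroup BorromeanComplement base :=
  Γ.g i j (pt v hi) (coe_mem_inSphere.2 hi) (coe_mem_inSphere.2 hj)

theorem Frame.gAt_mul (i j k : Piece) {v : R3} (hi : v ∈ i.fin) (hj : v ∈ j.fin) (hk : v ∈ k.fin) :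
    Γ.gAt i j v hi hj * Γ.gAt j k v hj hk = Γ.gAt i k v hi hk := Γ.g_mul _ _ _ _ _ _ _

theorem Frame.gAt_inv (i j : Piece) {v : R3} (hi : v ∈ i.fin) (hj : v ∈ j.fin) :
    (Γ.gAt i j v hi hj)⁻¹ = Γ.gAt j i v hj hi := Γ.g_inv _ _ _ _ _

theorem Frame.gAt_eq {i j : Piece} {v w : R3} (h : JoinedIn (i.fin ∩ j.fin) v w) :
    Γ.gAt i j v h.source_mem.1 h.source_mem.2 = Γ.gAt i j w h.target_mem.1 h.target_mem.2 :=
  Γ.g_eq_of_joinedIn (joinedIn_pt h.source_mem.1 h.target_mem.1 h)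

namespace Frame

variable {Γ}

theorem gAt_upper_outer (hΓ : Γ.Normalized) {v : R3} (h : v ∈ upper.fin) (h' : v ∈ outer.fin) :
    Γ.gAt upper outer v h h' = 1 := by
  rw [Γ.gAt_eq (joinedIn_upper_outer ⟨h, h'⟩ ⟨basePoint_mem_upper, basePoint_mem_outer⟩)]
  change FundamentalGroup.fromPath ((Γ.toPath outer base _).trans (Γ.toPath upper base _).symm) = 1
  rw [hΓ.1, hΓ.2.1]
  exact Path.Homotopic.Quotient.trans_symm _

theorem gAt_lower_outer (hΓ : Γ.Normalized) {v : R3} (h : v ∈ lower.fin) (h' : v ∈ outer.fin) :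
    Γ.gAt lower outer v h h' = 1 := by
  rw [Γ.gAt_eq (joinedIn_lower_outer ⟨h, h'⟩ ⟨nadir_mem_lower, nadir_mem_outer⟩)]
  change FundamentalGroup.fromPath ((Γ.toPath outer (pt nadir nadir_mem_lower) _).trans
    (Γ.toPath lower (pt nadir nadir_mem_lower) _).symm) = 1
  rw [hΓ.2.2.1]
  exact Path.Homotopic.Quotient.trans_symm _

theorem gAt_upper_mid (hΓ : Γ.Normalized) {r : RingIdx} {t : Bool} {v : R3} (h : v ∈ upper.fin)
    (h' : v ∈ (mid r t).fin) (hv : inside v r = false) : Γ.gAt upper (mid r t) v h h' = 1 := by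
  rw [Γ.gAt_eq (joinedIn_upper_mid ⟨h, h'⟩ ⟨corner_mem_upper r t false false,
    corner_mem_mid r t false false⟩ (by rw [hv, inside_corner_self]))]
  change FundamentalGroup.fromPath
    ((Γ.toPath (mid r t) (pt _ (corner_mem_mid r t false false)) _).trans
    (Γ.toPath upper (pt _ (corner_mem_mid r t false false)) _).symm) = 1
  rw [hΓ.2.2.2]
  exact Path.Homotopic.Quotient.trans_symm _

theorem gAt_upper_lower_of_outside (hΓ : Γ.Normalized) {v : R3} (h : v ∈ upper.fin)
    (h' : v ∈ lower.fin) (hv : ∀ r, inside v r = false) : Γ.gAt upper lower v h h' = 1 := by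
  obtain ⟨w, hw, hj⟩ := exists_joinedIn_outer ⟨h, h'⟩ hv
  rw [Γ.gAt_eq hj, ← Γ.gAt_mul upper outer lower _ hw, gAt_upper_outer hΓ, one_mul, ← Γ.gAt_inv,
    gAt_lower_outer hΓ, inv_one]

theorem gAt_upper_lower_congr (hΓ : Γ.Normalized) {v w : R3} (hv : v ∈ upper.fin)
    (hv' : v ∈ lower.fin) (hw : w ∈ upper.fin) (hw' : w ∈ lower.fin) (h : inside v = inside w) :
    Γ.gAt upper lower v hv hv' = Γ.gAt upper lower w hw hw' := by
  by_cases hne : ∃ r, inside v r = true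
  · exact Γ.gAt_eq (joinedIn_upper_lower ⟨hv, hv'⟩ ⟨hw, hw'⟩ h hne)
  · simp only [not_exists, Bool.not_eq_true] at hne
    rw [gAt_upper_lower_of_outside hΓ hv hv' hne, gAt_upper_lower_of_outside hΓ hw hw' (h ▸ hne)]

open Classical in
/-- The colouring of the faces by the fundamental group. -/
noncomputable def color (Γ : Frame base (fun i : Piece => i.set)) (φ : RingIdx → Bool) :
    FundamentalGroup BorromeanComplement base :=
  if h : ∃ v : R3, (v ∈ upper.fin ∧ v ∈ lower.fin) ∧ inside v = φ then
    Γ.gAt upper lower h.choose h.choose_spec.1.1 h.choose_spec.1.2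
  else 1

theorem gAt_upper_lower (hΓ : Γ.Normalized) {v : R3} (h : v ∈ upper.fin) (h' : v ∈ lower.fin) :
    Γ.gAt upper lower v h h' = Γ.color (inside v) := by
  have hex : ∃ w : R3, (w ∈ upper.fin ∧ w ∈ lower.fin) ∧ inside w = inside v := ⟨v, ⟨h, h'⟩, rfl⟩
  rw [color, dif_pos hex]
  exact gAt_upper_lower_congr hΓ _ _ _ _ hex.choose_spec.2.symm

theorem color_pat (hΓ : Γ.Normalized) (r : RingIdx) (t o u : Bool) :
    Γ.color (pat r o u t) =
      Γ.gAt upper (mid r t) _ (corner_mem_upper r t o u) (corner_mem_mid r t o u) *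
        Γ.gAt (mid r t) lower _ (corner_mem_mid r t o u) (corner_mem_lower r t o u) := by
  rw [Γ.gAt_mul, gAt_upper_lower hΓ, inside_corner]

theorem gAt_upper_corner (r : RingIdx) (t o u u' : Bool) :
    Γ.gAt upper (mid r t) _ (corner_mem_upper r t o u) (corner_mem_mid r t o u) =
      Γ.gAt upper (mid r t) _ (corner_mem_upper r t o u') (corner_mem_mid r t o u') :=
  Γ.gAt_eq (joinedIn_upper_mid ⟨corner_mem_upper r t o u, corner_mem_mid r t o u⟩
    ⟨corner_mem_upper r t o u', corner_mem_mid r t o u'⟩ (by simp only [inside_corner_self]))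

theorem gAt_lower_corner (r : RingIdx) (t o o' u : Bool) :
    Γ.gAt lower (mid r t) _ (corner_mem_lower r t o u) (corner_mem_mid r t o u) =
      Γ.gAt lower (mid r t) _ (corner_mem_lower r t o' u) (corner_mem_mid r t o' u) :=
  Γ.gAt_eq (joinedIn_lower_mid ⟨corner_mem_lower r t o u, corner_mem_mid r t o u⟩
    ⟨corner_mem_lower r t o' u, corner_mem_mid r t o' u⟩ (by simp only [inside_corner_under]))

theorem isDehn_color (hΓ : Γ.Normalized) : IsDehn Γ.color := by
  constructor
  · have h := gAt_upper_lower hΓ (Arc.start_mem_upper .a) (Arc.start_mem_lower .a)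
    rw [Arc.inside_start] at h
    rw [← Arc.startFace, ← h]
    refine gAt_upper_lower_of_outside hΓ _ _ fun r => ?_
    rw [Arc.inside_start]
    cases r <;> rfl
  · intro r t
    simp only [color_pat hΓ]
    rw [gAt_upper_corner r t true false true, gAt_upper_corner r t false false true,
      ← Γ.gAt_inv lower _ (corner_mem_lower r t true false), gAt_lower_corner r t true false false,
      ← Γ.gAt_inv lower _ (corner_mem_lower r t true true), gAt_lower_corner r t true false true,
      ← Γ.gAt_inv lower _ (corner_mem_lower r t false false),
      ← Γ.gAt_inv lower _ (corner_mem_lower r t false true)]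
    group

theorem meridian_eq (hΓ : Γ.Normalized) (g : Arc) : g.meridian = IsDehn.ofArc Γ.color g := by
  rw [IsDehn.ofArc, ← g.inside_finish, ← g.inside_start,
    ← gAt_upper_lower hΓ g.finish_mem_upper g.finish_mem_lower,
    ← gAt_upper_lower hΓ g.start_mem_upper g.start_mem_lower, Γ.gAt_inv]
  have h1 := Γ.toPath_trans upper _ _ (coe_mem_inSphere.2 basePoint_mem_upper)
    (coe_mem_inSphere.2 g.start_mem_upper) g.startPath g.startPath_mem
  have h2 := Γ.toPath_trans upper _ _ (coe_mem_inSphere.2 basePoint_mem_upper)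
    (coe_mem_inSphere.2 g.finish_mem_upper) g.finishPath g.finishPath_mem
  have h3 := Γ.toPath_trans lower _ _ (coe_mem_inSphere.2 g.start_mem_lower)
    (coe_mem_inSphere.2 g.finish_mem_lower) g.underPath g.underPath_mem
  rw [hΓ.1, Path.Homotopic.Quotient.refl_trans] at h1 h2
  rw [Arc.meridian, Arc.loop_eq, Path.Homotopic.Quotient.mk_trans, Path.Homotopic.Quotient.mk_trans,
    Path.Homotopic.Quotient.mk_symm, h1, h2]
  change _ = Path.Homotopic.Quotient.trans
    (Path.Homotopic.Quotient.trans (Γ.toPath upper (toComplement g.start g.start_notMem) _)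
      (Γ.toPath lower (toComplement g.start g.start_notMem) _).symm)
    (Path.Homotopic.Quotient.trans (Γ.toPath lower (toComplement g.finish g.finish_notMem) _)
      (Γ.toPath upper (toComplement g.finish g.finish_notMem) _).symm)
  rw [← h3]
  exact (quotient_trans_symm_trans_trans _ _ _ _).symm

theorem gAt_mem (hΓ : Γ.Normalized) {H : Subgroup (FundamentalGroup BorromeanComplement base)}
    (hH : ∀ φ, Γ.color φ ∈ H) (i j : Piece) {v : R3} (hi : v ∈ i.fin) (hj : v ∈ j.fin) :
    Γ.gAt i j v hi hj ∈ H := by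
  have hsymm : ∀ {i j : Piece} {v : R3} {hi : v ∈ i.fin} {hj : v ∈ j.fin},
      Γ.gAt i j v hi hj ∈ H → Γ.gAt j i v hj hi ∈ H := by
    intro i j v hi hj h
    rw [← Γ.gAt_inv]
    exact H.inv_mem h
  have hself : ∀ {i : Piece} {v : R3} {hi : v ∈ i.fin}, Γ.gAt i i v hi hi ∈ H := by
    intro i v hi
    have h : Γ.gAt i i v hi hi = 1 := Γ.g_self _ _ _
    rw [h]
    exact H.one_mem
  have hUW : ∀ {v : R3} {h : v ∈ upper.fin} {h' : v ∈ lower.fin}, Γ.gAt upper lower v h h' ∈ H :=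
    fun {v h h'} => gAt_upper_lower hΓ h h' ▸ hH _
  have hUV : ∀ {v : R3} {h : v ∈ upper.fin} {h' : v ∈ outer.fin}, Γ.gAt upper outer v h h' ∈ H :=
    fun {v h h'} => gAt_upper_outer hΓ h h' ▸ H.one_mem
  have hWV : ∀ {v : R3} {h : v ∈ lower.fin} {h' : v ∈ outer.fin}, Γ.gAt lower outer v h h' ∈ H :=
    fun {v h h'} => gAt_lower_outer hΓ h h' ▸ H.one_mem
  have hWN : ∀ {r t} {v : R3} {h : v ∈ lower.fin} {h' : v ∈ (mid r t).fin},
      Γ.gAt lower (mid r t) v h h' ∈ H := by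
    intro r t v h h'
    rw [Γ.gAt_eq (joinedIn_lower_mid ⟨h, h'⟩ ⟨corner_mem_lower r t false _,
      corner_mem_mid r t false _⟩ (inside_corner_under r t false _).symm),
      ← Γ.gAt_mul lower upper _ _ (corner_mem_upper r t false _)]
    refine H.mul_mem (hsymm hUW) ?_
    rw [gAt_upper_mid hΓ _ _ (inside_corner_self r t false _)]
    exact H.one_mem
  have hUN : ∀ {r t} {v : R3} {h : v ∈ upper.fin} {h' : v ∈ (mid r t).fin},
      Γ.gAt upper (mid r t) v h h' ∈ H := by
    intro r t v h h'
    rw [Γ.gAt_eq (joinedIn_upper_mid ⟨h, h'⟩ ⟨corner_mem_upper r t _ false,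
      corner_mem_mid r t _ false⟩ (inside_corner_self r t _ false).symm),
      ← Γ.gAt_mul upper lower _ _ (corner_mem_lower r t _ false)]
    exact H.mul_mem hUW hWN
  cases i with
  | upper =>
    cases j with
    | upper => exact hself
    | lower => exact hUW
    | outer => exact hUV
    | mid r t => exact hUN
  | lower =>
    cases j with
    | upper => exact hsymm hUW
    | lower => exact hself
    | outer => exact hWV
    | mid r t => exact hWN
  | outer =>
    cases j with
    | upper => exact hsymm hUV
    | lower => exact hsymm hWV
    | outer => exact hself
    | mid r t => exact (mid_outer_disjoint hj hi).elim
  | mid r t =>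
    cases j with
    | upper => exact hsymm hUN
    | lower => exact hsymm hWN
    | outer => exact (mid_outer_disjoint hi hj).elim
    | mid r' t' =>
      obtain ⟨rfl, rfl⟩ := (Piece.mid.injEq ..).mp (mid_disjoint hi hj)
      exact hself

theorem subgroup_eq_top (hΓ : Γ.Normalized)
    {H : Subgroup (FundamentalGroup BorromeanComplement base)}
    (hH : ∀ φ, Γ.color φ ∈ H) : H = ⊤ := by
  refine Frame.eq_top (Γ := Γ) isOpen_set exists_mem_set ?_ _ hΓ.1
  intro i j p hi hj
  by_cases h : i = j
  · subst h
    rw [Frame.g_self]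
    exact H.one_mem
  · obtain ⟨v, hv, hv', rfl⟩ := exists_fin_of_ne h hi hj
    exact gAt_mem hΓ hH i j hv hv'

end Frame

end Color

theorem pathConnectedSpace_borromeanComplement : PathConnectedSpace BorromeanComplement := by
  obtain ⟨Γ, -⟩ := exists_normalized_frame
  have h : ∀ x, Joined base x := fun x => by
    obtain ⟨i, hi⟩ := exists_mem_set x
    obtain ⟨p⟩ := Γ.toPath i x hi
    exact ⟨p⟩
  exact ⟨⟨base⟩, fun x y => (h x).symm.trans (h y)⟩

/-! ### The presentations of the fundamental group -/

/-- The Wirtinger presentation. -/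
theorem exists_wirtinger_mulEquiv :
    ∃ φ : PresentedGroup Wirtinger.rels ≃* FundamentalGroup BorromeanComplement base,
      ∀ g : Arc, φ (PresentedGroup.of g) = g.meridian := by
  obtain ⟨Γ, hΓ⟩ := exists_normalized_frame
  obtain ⟨ψ, hψ⟩ := exists_hom_of_isDehn Wirtinger.isDehn_color
  have hΓ' := Frame.isDehn_color hΓ
  let φ : PresentedGroup Wirtinger.rels →* FundamentalGroup BorromeanComplement base :=
    PresentedGroup.toGroup fun _ hw => hΓ'.lift_eq_one hw
  have hφ : ∀ g : Arc, φ (PresentedGroup.of g) = g.meridian := fun g =>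
    (PresentedGroup.toGroup.of _).trans (Frame.meridian_eq hΓ g).symm
  have hψφ : ψ.comp φ = MonoidHom.id _ := PresentedGroup.ext fun g => by
    rw [MonoidHom.comp_apply, hφ, hψ, Wirtinger.ofArc_color, MonoidHom.id_apply]
  have hinj : Function.Injective φ :=
    Function.LeftInverse.injective (g := ψ) fun w => DFunLike.congr_fun hψφ w
  have hsurj : Function.Surjective φ := MonoidHom.range_eq_top.1 <|
    Frame.subgroup_eq_top hΓ <| hΓ'.mem_of_forall_ofArc fun g =>
      ⟨PresentedGroup.of g, PresentedGroup.toGroup.of _⟩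
  exact ⟨MulEquiv.ofBijective φ ⟨hinj, hsurj⟩, hφ⟩

namespace Reduced

theorem eliminate_R₆ :
    eliminate Wirtinger.R₆ = (eliminate Wirtinger.R₃ * eliminate Wirtinger.R₂)⁻¹ := by
  simp only [eliminate, Wirtinger.R₆, Wirtinger.R₃, Wirtinger.R₂, map_mul, map_inv,
    FreeGroup.lift_apply_of]
  group

theorem comm_c_eq : comm (gen .c)⁻¹ (comm (gen .b)⁻¹ (gen .a)) =
    (gen .a)⁻¹ * eliminate Wirtinger.R₂ * gen .a := by
  simp only [eliminate, Wirtinger.R₂, comm, map_mul, map_inv, FreeGroup.lift_apply_of]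
  group

theorem comm_b_eq : comm (gen .b) (comm (gen .c) (gen .a)⁻¹) =
    (gen .a * gen .c * (gen .a)⁻¹ * gen .b)⁻¹ * eliminate Wirtinger.R₃ *
      (gen .a * gen .c * (gen .a)⁻¹ * gen .b) := by
  simp only [eliminate, Wirtinger.R₃, comm, map_mul, map_inv, FreeGroup.lift_apply_of]
  group

theorem lift_toArc_eliminate (w : FreeGroup Arc) :
    FreeGroup.lift (fun g : Gen => Wirtinger.arc g.toArc) (eliminate w) =
      PresentedGroup.mk Wirtinger.rels w := by
  obtain ⟨⟨h1, -, -⟩, h4, h5, -⟩ := Wirtinger.arc_relations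
  rw [← eq_mul_inv_iff_mul_eq] at h1 h4 h5
  rw [← MonoidHom.comp_apply]
  refine DFunLike.congr_fun (FreeGroup.ext_hom _ _ fun g => ?_) w
  change _ = Wirtinger.arc g
  cases g <;> simp [eliminate, Gen.toArc, h1, h4, h5]

theorem lift_toArc_eq_one {w : FreeGroup Gen} (hw : w ∈ rels) :
    FreeGroup.lift (fun g : Gen => Wirtinger.arc g.toArc) w = 1 := by
  rcases hw with rfl | rfl
  · rw [comm_c_eq, map_mul, map_mul, lift_toArc_eliminate,
      Wirtinger.mk_eq_one (w := Wirtinger.R₂) (by simp [Wirtinger.rels]), mul_one, ← map_mul,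
      inv_mul_cancel, map_one]
  · rw [comm_b_eq, map_mul, map_mul, lift_toArc_eliminate,
      Wirtinger.mk_eq_one (w := Wirtinger.R₃) (by simp [Wirtinger.rels]), mul_one, ← map_mul,
      inv_mul_cancel, map_one]

theorem mk_eliminate_eq_one {w : FreeGroup Arc} (hw : w ∈ Wirtinger.rels) :
    PresentedGroup.mk rels (eliminate w) = 1 := by
  have h2 : PresentedGroup.mk rels (eliminate Wirtinger.R₂) = 1 := by
    have h := PresentedGroup.mk_eq_one_iff.2 <| Subgroup.subset_normalClosure (s := rels)
      (show comm (gen .c)⁻¹ (comm (gen .b)⁻¹ (gen .a)) ∈ rels by simp [rels])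
    rwa [comm_c_eq, map_mul, map_mul, map_inv, mul_eq_one_iff_eq_inv, mul_eq_left] at h
  have h3 : PresentedGroup.mk rels (eliminate Wirtinger.R₃) = 1 := by
    have h := PresentedGroup.mk_eq_one_iff.2 <| Subgroup.subset_normalClosure (s := rels)
      (show comm (gen .b) (comm (gen .c) (gen .a)⁻¹) ∈ rels by simp [rels])
    rwa [comm_b_eq, map_mul, map_mul, map_inv, mul_eq_one_iff_eq_inv, mul_eq_left] at h
  rcases hw with rfl | rfl | rfl | rfl | rfl | rfl
  · simp [eliminate, Wirtinger.R₁, mul_assoc]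
  · exact h2
  · exact h3
  · simp [eliminate, Wirtinger.R₄]
  · simp [eliminate, Wirtinger.R₅]
  · rw [eliminate_R₆, map_inv, map_mul, h2, h3, mul_one, inv_one]

/-- The elimination of three generators from the Wirtinger presentation. -/
theorem exists_mulEquiv :
    ∃ χ : PresentedGroup rels ≃* PresentedGroup Wirtinger.rels,
      ∀ g : Gen, χ (PresentedGroup.of g) = PresentedGroup.of g.toArc := by
  let χ : PresentedGroup rels →* PresentedGroup Wirtinger.rels :=
    PresentedGroup.toGroup fun _ hw => lift_toArc_eq_one hw
  have hχ : ∀ g : Gen, χ (PresentedGroup.of g) = Wirtinger.arc g.toArc := fun g =>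
    PresentedGroup.toGroup.of _
  let ξ : PresentedGroup Wirtinger.rels →* PresentedGroup rels :=
    PresentedGroup.toGroup (f := fun g => PresentedGroup.mk rels (eliminate (FreeGroup.of g)))
      fun w hw => by
        rw [← mk_eliminate_eq_one hw, ← MonoidHom.comp_apply]
        exact DFunLike.congr_fun (FreeGroup.ext_hom _ _ fun g => by simp) w
  have hξ : ∀ g : Arc,
      ξ (Wirtinger.arc g) = PresentedGroup.mk rels (eliminate (FreeGroup.of g)) := fun g =>
    PresentedGroup.toGroup.of _
  refine ⟨MonoidHom.toMulEquiv χ ξ (PresentedGroup.ext fun g => ?_)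
    (PresentedGroup.ext fun g => ?_), hχ⟩
  · rw [MonoidHom.comp_apply, hχ, hξ]
    cases g <;> simp only [eliminate, Gen.toArc, FreeGroup.lift_apply_of] <;> rfl
  · rw [MonoidHom.comp_apply, hξ]
    exact lift_toArc_eliminate _

end Reduced

theorem mainTheorem2 :
    -- the six Wirtinger generators and relators present the fundamental group
    (∃ φ : PresentedGroup Wirtinger.rels ≃* FundamentalGroup BorromeanComplement base,
      ∀ g : Arc, φ (PresentedGroup.of g) = g.meridian) ∧
    -- after the elimination of `d`, `e`, `f` one relator is redundant
    Reduced.eliminate Wirtinger.R₆ =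
      (Reduced.eliminate Wirtinger.R₃ * Reduced.eliminate Wirtinger.R₂)⁻¹ ∧
    -- the reduced presentation, on the meridians of the arcs `a`, `b`, `c`
    (∃ ψ : PresentedGroup Reduced.rels ≃* FundamentalGroup BorromeanComplement base,
      ∀ g : Gen, ψ (PresentedGroup.of g) = g.toArc.meridian) ∧
    -- the isomorphism type does not depend on the base point
    ∀ x : BorromeanComplement,
      Nonempty (FundamentalGroup BorromeanComplement x ≃* PresentedGroup Reduced.rels) := by
  obtain ⟨φ, hφ⟩ := exists_wirtinger_mulEquiv
  obtain ⟨χ, hχ⟩ := Reduced.exists_mulEquiv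
  have := pathConnectedSpace_borromeanComplement
  refine ⟨⟨φ, hφ⟩, Reduced.eliminate_R₆, ⟨χ.trans φ, fun g => ?_⟩, fun x => ⟨?_⟩⟩
  · rw [MulEquiv.trans_apply, hχ, hφ]
  · exact (FundamentalGroup.fundamentalGroupMulEquivOfPathConnected x base).trans
      (χ.trans φ).symm
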